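/- Conventions. $\mathbb S^2$ is the set of unit vectors of $\mathbb R^3$, $(x\otimes y)z=(y\cdot z)\,x$, and $\mathrm{cof}$ is the cofactor matrix. Let $U\neq V$ be symmetric positive definite $3\times3$ matrices. *Type II twin.* Suppose there is $e\in\mathbb S^2$, unique up to sign, with $V=(-1+2e\otimes e)\,U\,(-1+2e\otimes e)$. A type II twin generated by $U,V$ is a triple $(U,b,m)$ with $m\in\mathbb S^2$, $b\in\mathbb R^3$ and $$b\otimes m=Ue\otimes 2\Bigl(e-\frac{U^2e}{|Ue|^2}\Bigr),$$ together with the rotation $R\in SO(3)$ for which $RV-U=b\otimes m$. *Cofactor conditions.* $(U,b,m)$ satisfies the cofactor conditions if the middle eigenvalue of $U$ is $1$, $b\cdot U\,\mathrm{cof}(U^2-1)\,m=0$, and $\mathrm{tr}\,U^2-\det U^2-\frac14|b|^2|m|^2-2\ge0$. For a type II twin there are then $a_U,a_V\in\mathbb R^3$ and $R_U,R_V\in SO(3)$ with $R_UU=1+a_U\otimes m$, $R_VV=1+a_V\otimes m$, $R_V=R_UR$, and $a_U,a_V$ are unique. *Star and half-star twins.* Let $\mathcal M$ be a set of symmetric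 positive definite matrices containing $U,V$, and let $(U,b,m)$ be a type II twin generated by $U,V$ that satisfies the cofactor conditions. It is a (type II) *star twin* if there are $\mu^*\in(0,1)$ and three different rotations $Q_1,Q_2,Q_3\in SO(3)\setminus\{1\}$ such that - (T1) $Q_iUQ_i^T,\ Q_iVQ_i^T\in\mathcal M$ for every $i$; - (T2) $Q_i\bigl(\mu^*a_U+(1-\mu^*)a_V\bigr)=\chi_i\bigl(\mu^*a_U+(1-\mu^*)a_V\bigr)$ with $\chi_i\in\{1,-1\}$, for every $i$; - (T3) $(Q_im\times Q_jm)\cdot m\neq0$ for all $i\neq j$, and $(Q_1m\times Q_2m)\cdot Q_3m\neq0$. It is a (type II) *half-star twin* if it is not a star twin but there are $\mu^*\in(0,1)$ and two different rotations $Q_1,Q_2\in SO(3)\setminus\{1\}$ satisfying (T1), (T2) and $(Q_1m\times Q_2m)\cdot m\ne0$. **Theorem.** Let $a,b,c,d>0$ be such that the twelve cubic-to-monoclinic variants $$ \begin{aligned} &U_{1,2}=\begin{pmatrix}a&\pm b&0\\ \pm b&c&0\\0&0&d\end{pmatrix},\quad U_{3,4}=\begin{pmatrix}c&\pm b&0\\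 \pm b&a&0\\0&0&d\end{pmatrix},\quad U_{5,6}=\begin{pmatrix}a&0&\pm b\\0&d&0\\ \pm b&0&c\end{pmatrix},\\ &U_{7,8}=\begin{pmatrix}c&0&\pm b\\0&d&0\\ \pm b&0&a\end{pmatrix},\quad U_{9,10}=\begin{pmatrix}d&0&0\\0&a&\pm b\\0&\pm b&c\end{pmatrix},\quad U_{11,12}=\begin{pmatrix}d&0&0\\0&c&\pm b\\0&\pm b&a\end{pmatrix} \end{aligned} $$ (upper sign for the first index) are positive definite, and let $\mathcal M=\{U_1,\dots,U_{12}\}$. Let $i\ne j$, and let $(U_i,\mathbf b,\mathbf m)$ be a type II twin generated by $U_i,U_j$ that satisfies the cofactor conditions. Then the ordered eigenvalues of $U_1$ satisfy $0<\lambda_1\le\lambda_2=1\le\lambda_3$, and the following hold. 1. The twin is a half-star twin if and only if one of the following holds: - $d\ne1$, $\lambda_1=d$, $\lambda_1\lambda_3\neq1$ and $4d^2(d^2+\lambda_3^2-2)=(d-\lambda_3)^2(1-d^2)$; - $d\ne1$, $\lambda_3=d$ and $4d^2(d^2+\lambda_1^2-2)=(d-\lambda_1)^2(1-d^2)$; -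 $d=1$, $\lambda_3>1$ and $\lambda_1^2(5\lambda_3^2-1)=8\lambda_1\lambda_3-5+\lambda_3^2$. 2. The twin is a star twin if and only if $a\neq c$ and one of the following holds: - $d\ne1$, $\lambda_1=d$ and $d^2(d^2+\lambda_3^2-2)=(d-\lambda_3)^2(1-d^2)$; - $d\ne1$, $\lambda_3=d$ and $d^2(d^2+\lambda_1^2-2)=(d-\lambda_1)^2(1-d^2)$. -/

import Mathlib

open Matrix

namespace StarTwin

/-- Real `3 × 3` matrices. -/
abbrev Mat3 : Type := Matrix (Fin 3) (Fin 3) ℝ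

/-- Vectors of `ℝ³`. The Euclidean scalar product is the dot product `v ⬝ᵥ w`, the tensor product
`v ⊗ w` is `Matrix.vecMulVec v w`. -/
abbrev Vec3 : Type := Fin 3 → ℝ

/-- The twelve cubic-to-monoclinic variants with parameters `a, b, c, d`; the index `i : Fin 12`
stands for `U_{i+1}`. -/
def variant (a b c d : ℝ) : Fin 12 → Mat3 :=
  ![!![a, b, 0; b, c, 0; 0, 0, d],
    !![a, -b, 0; -b, c, 0; 0, 0, d],
    !![c, b, 0; b, a, 0; 0, 0, d],
    !![c, -b, 0; -b, a, 0; 0, 0, d],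
    !![a, 0, b; 0, d, 0; b, 0, c],
    !![a, 0, -b; 0, d, 0; -b, 0, c],
    !![c, 0, b; 0, d, 0; b, 0, a],
    !![c, 0, -b; 0, d, 0; -b, 0, a],
    !![d, 0, 0; 0, a, b; 0, b, c],
    !![d, 0, 0; 0, a, -b; 0, -b, c],
    !![d, 0, 0; 0, c, b; 0, b, a],
    !![d, 0, 0; 0, c, -b; 0, -b, a]]

/-- `l₁ ≤ l₂ ≤ l₃` are the eigenvalues of `U`, counted with multiplicity. -/
def OrderedEigenvalues (U : Mat3) (l₁ l₂ l₃ : ℝ) : Prop :=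
  l₁ ≤ l₂ ∧ l₂ ≤ l₃ ∧
    U.charpoly = (Polynomial.X - Polynomial.C l₁) * (Polynomial.X - Polynomial.C l₂) *
      (Polynomial.X - Polynomial.C l₃)

/-- The cofactor matrix. -/
def cof (A : Mat3) : Mat3 := A.adjugateᵀ

/-- The matrix `-1 + 2 e ⊗ e`; for a unit vector `e` it is the rotation by `π` about `e`. -/
def twofold (e : Vec3) : Mat3 := -1 + (2 : ℝ) • vecMulVec e e

/-- `e` is a unit vector with `V = (-1 + 2 e ⊗ e) U (-1 + 2 e ⊗ e)`. -/
def IsTwinAxis (U V : Mat3) (e : Vec3) : Prop :=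
  e ⬝ᵥ e = 1 ∧ V = twofold e * U * twofold e

/-- The vector `b_II = U e`. -/
def bII (U : Mat3) (e : Vec3) : Vec3 := U *ᵥ e

/-- The (not normalized) vector `m_II = 2 (e - U² e / |U e|²)`. -/
noncomputable def mII (U : Mat3) (e : Vec3) : Vec3 :=
  (2 : ℝ) • (e - ((U *ᵥ e) ⬝ᵥ (U *ᵥ e))⁻¹ • ((U * U) *ᵥ e))

/-- `(U, b, m)` is the type II twin generated by the distinct positive definite symmetric
matrices `U`, `V`, with rotation `R`: the axis `e` is unique up to its sign, `R V = U + b ⊗ m`,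
`b ⊗ m = b_II ⊗ m_II`, and `m` is normalized to be a unit vector. -/
structure IsTypeIITwin (U V R : Mat3) (b m : Vec3) : Prop where
  posDef_left : U.PosDef
  posDef_right : V.PosDef
  ne : U ≠ V
  rotation : R ∈ specialOrthogonalGroup (Fin 3) ℝ
  compatible : R * V - U = vecMulVec b m
  unit : m ⬝ᵥ m = 1
  typeII : ∃ e : Vec3, IsTwinAxis U V e ∧ (∀ e' : Vec3, IsTwinAxis U V e' → e' = e ∨ e' = -e) ∧
    vecMulVec b m = vecMulVec (bII U e) (mII U e)

/-- The cofactor conditions for `(U, b, m)`: the middle eigenvalue of `U` is `1`,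
`b · U cof(U² - 1) m = 0`, and `tr U² - det U² - |b|² |m|² / 4 - 2 ≥ 0`. -/
structure CofactorConditions (U : Mat3) (b m : Vec3) : Prop where
  cc1 : ∃ l₁ l₃ : ℝ, OrderedEigenvalues U l₁ 1 l₃
  cc2 : b ⬝ᵥ ((U * cof (U * U - 1)) *ᵥ m) = 0
  cc3 : 0 ≤ (U * U).trace - (U * U).det - (1 / 4) * (b ⬝ᵥ b) * (m ⬝ᵥ m) - 2

/-- The vectors `aU`, `aV` with `R_U U = 1 + aU ⊗ m`, `R_V V = 1 + aV ⊗ m`, `R_V = R_U R`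
for some rotations `R_U`, `R_V`. -/
def AusteniteVectors (U V R : Mat3) (m aU aV : Vec3) : Prop :=
  ∃ RU ∈ specialOrthogonalGroup (Fin 3) ℝ, ∃ RV ∈ specialOrthogonalGroup (Fin 3) ℝ,
    RU * U = 1 + vecMulVec aU m ∧ RV * V = 1 + vecMulVec aV m ∧ RV = RU * R

/-- The `n` rotations `Q 0, …, Q (n-1)` are distinct, different from the identity, map `U` and `V`
into `M` by conjugation, map `μ aU + (1 - μ) aV` to itself or to its opposite, and any three of
`m, Q 0 m, …, Q (n-1) m` are linearly independent. -/
structure StarRotations (M : Set Mat3) (U V : Mat3) (m aU aV : Vec3) (μ : ℝ) (n : ℕ)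
    (Q : Fin n → Mat3) : Prop where
  rotation : ∀ i, Q i ∈ specialOrthogonalGroup (Fin 3) ℝ
  ne_one : ∀ i, Q i ≠ 1
  distinct : Function.Injective Q
  t1 : ∀ i, Q i * U * (Q i)ᵀ ∈ M ∧ Q i * V * (Q i)ᵀ ∈ M
  t2 : ∀ i, ∃ χ : ℝ, (χ = 1 ∨ χ = -1) ∧
    Q i *ᵥ (μ • aU + (1 - μ) • aV) = χ • (μ • aU + (1 - μ) • aV)
  t3_pair : ∀ i j, i ≠ j → crossProduct (Q i *ᵥ m) (Q j *ᵥ m) ⬝ᵥ m ≠ 0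
  t3_triple : ∀ i j k, i ≠ j → i ≠ k → j ≠ k →
    crossProduct (Q i *ᵥ m) (Q j *ᵥ m) ⬝ᵥ (Q k *ᵥ m) ≠ 0

/-- There are `n` rotations as above for some `μ* ∈ (0, 1)`. -/
def HasStarRotations (M : Set Mat3) (U V R : Mat3) (m : Vec3) (n : ℕ) : Prop :=
  ∃ aU aV : Vec3, AusteniteVectors U V R m aU aV ∧
    ∃ μ ∈ Set.Ioo (0 : ℝ) 1, ∃ Q : Fin n → Mat3, StarRotations M U V m aU aV μ n Q

/-- `(U, b, m)` is a type II star twin generated by `(U, V)`, relative to the set `M`: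
there are three such rotations. -/
structure IsTypeIIStarTwin (M : Set Mat3) (U V R : Mat3) (b m : Vec3) : Prop where
  mem_left : U ∈ M
  mem_right : V ∈ M
  twin : IsTypeIITwin U V R b m
  cofactor : CofactorConditions U b m
  star : HasStarRotations M U V R m 3

/-- `(U, b, m)` is a type II half-star twin generated by `(U, V)`, relative to the set `M`:
there are two such rotations, and not three. -/
structure IsTypeIIHalfStarTwin (M : Set Mat3) (U V R : Mat3) (b m : Vec3) : Prop where
  mem_left : U ∈ M
  mem_right : V ∈ M
  twin : IsTypeIITwin U V R b m
  cofactor : CofactorConditions U b m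
  half_star : HasStarRotations M U V R m 2
  not_star : ¬ HasStarRotations M U V R m 3

end StarTwin

namespace StarTwin

/-! If some eigenvector of `U` were orthogonal to the twin axis `e`, the half-turn about it would
commute with `U`, and composing it with the half-turn about `e` would give a second twin axis.
Uniqueness of `e` therefore makes `d` a simple eigenvalue and `e` a face diagonal of the cube that
exchanges the `d`-eigenlines of the two variants (`axis_of_unique_axis`). A cubic rotation then
normalizes the pair to `base`, `baseTwin` with axis `(0, s, s)`, `s² = 1/2` (`exists_conj_base`).

Simplicity of `d` also turns (T1) into a discrete condition: a rotation sending both matrices to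
variants maps two coordinate axes to coordinate axes, so it is a signed permutation
(`isSignedPerm_of_conj_mem`). The second cofactor condition, combined with the eigenvalue `1`, says
`|U e| = 1` (`TwinData.norm_eq`). This fixes the direction of `m`, and `m` with `U`, `V` determines
`a_U`, `a_V` (`austenite_unique`). What is left is a count: given the line of `A = μ a_U + (1 - μ)
a_V`, which cubic rotations preserve it, and are the images of `m` in general position?

If `d ≠ 1`, two such rotations force `A` to be a diagonal of the cube or of a face
(`cubicStar_two`). Around a cube diagonal the images of `m` lie on three lines including that of
`m`, so at most two rotations are usable; around a face diagonal three half-turns are available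
(`cubicStar_three`, `exists_cubicStar_face`). A cube diagonal needs `μ = 1/2`, a face diagonal needs
one coordinate of `A` to vanish; the two resulting equations differ by the factor `4`
(`star_iff_of_ne_one`). If `d = 1`, `m` is a coordinate axis, only two other axes exist, so three
rotations are impossible, and two require a cube diagonal (`star_iff_of_one`). The last step
rewrites the equations in the eigenvalues (`core_of_ne_one`, `core_of_one`). -/

/-! ### Conjugation by rotations and transport of the twin data. -/

lemma mem_rotation_iff {Q : Mat3} :
    Q ∈ specialOrthogonalGroup (Fin 3) ℝ ↔ Q * Qᵀ = 1 ∧ Q.det = 1 := by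
  rw [mem_specialOrthogonalGroup_iff, mem_orthogonalGroup_iff]

lemma transpose_mul_self_of_rotation {Q : Mat3} (h : Q ∈ specialOrthogonalGroup (Fin 3) ℝ) :
    Qᵀ * Q = 1 := mul_eq_one_comm.mp (mem_rotation_iff.mp h).1

lemma rotation_transpose {Q : Mat3} (h : Q ∈ specialOrthogonalGroup (Fin 3) ℝ) :
    Qᵀ ∈ specialOrthogonalGroup (Fin 3) ℝ := by
  rw [mem_rotation_iff, transpose_transpose, det_transpose]
  exact ⟨transpose_mul_self_of_rotation h, (mem_rotation_iff.mp h).2⟩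

/-- Conjugation by `P`. -/
def conj (P X : Mat3) : Mat3 := P * X * Pᵀ

section conj
variable {P : Mat3} (hP : P ∈ specialOrthogonalGroup (Fin 3) ℝ)
include hP

lemma dotProduct_rotation (x y : Vec3) : (P *ᵥ x) ⬝ᵥ (P *ᵥ y) = x ⬝ᵥ y := by
  rw [dotProduct_mulVec, vecMul_mulVec, transpose_mul_self_of_rotation hP, vecMul_one]

lemma transpose_mulVec_mulVec (x : Vec3) : Pᵀ *ᵥ (P *ᵥ x) = x := by
  rw [mulVec_mulVec, transpose_mul_self_of_rotation hP, one_mulVec]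

lemma conj_mul (X Y : Mat3) : conj P (X * Y) = conj P X * conj P Y := by
  have h : conj P X * conj P Y = P * X * (Pᵀ * P) * Y * Pᵀ := by
    simp only [conj, Matrix.mul_assoc]
  rw [h, transpose_mul_self_of_rotation hP, Matrix.mul_one, conj, Matrix.mul_assoc P X Y]

lemma conj_one : conj P 1 = 1 := by
  rw [conj, Matrix.mul_one, (mem_rotation_iff.mp hP).1]

lemma conj_mulVec (X : Mat3) (x : Vec3) : conj P X *ᵥ (P *ᵥ x) = P *ᵥ (X *ᵥ x) := by
  rw [conj, mulVec_mulVec, Matrix.mul_assoc, transpose_mul_self_of_rotation hP, Matrix.mul_one,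
    mulVec_mulVec]

lemma conj_transpose_conj (X : Mat3) : conj Pᵀ (conj P X) = X := by
  have h : conj Pᵀ (conj P X) = (Pᵀ * P) * X * (Pᵀ * P) := by
    simp only [conj, Matrix.mul_assoc, transpose_transpose]
  rw [h, transpose_mul_self_of_rotation hP, Matrix.mul_one, Matrix.one_mul]

lemma conj_injective : Function.Injective (conj P) :=
  Function.LeftInverse.injective (conj_transpose_conj hP)

lemma conj_rotation {Q : Mat3} (hQ : Q ∈ specialOrthogonalGroup (Fin 3) ℝ) :
    conj P Q ∈ specialOrthogonalGroup (Fin 3) ℝ := by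
  rw [conj]
  exact mul_mem (mul_mem hP hQ) (rotation_transpose hP)

end conj

lemma conj_add (P X Y : Mat3) : conj P (X + Y) = conj P X + conj P Y := by
  simp only [conj, Matrix.mul_add, Matrix.add_mul]

lemma conj_sub (P X Y : Mat3) : conj P (X - Y) = conj P X - conj P Y := by
  simp only [conj, Matrix.mul_sub, Matrix.sub_mul]

lemma conj_transpose (P X : Mat3) : conj P Xᵀ = (conj P X)ᵀ := by
  simp only [conj, transpose_mul, transpose_transpose, Matrix.mul_assoc]

lemma conj_vecMulVec (P : Mat3) (x y : Vec3) :
    conj P (vecMulVec x y) = vecMulVec (P *ᵥ x) (P *ᵥ y) := by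
  rw [conj, mul_vecMulVec, vecMulVec_mul, vecMul_transpose]

lemma conj_twofold {P : Mat3} (hP : P ∈ specialOrthogonalGroup (Fin 3) ℝ) (e : Vec3) :
    conj P (twofold e) = twofold (P *ᵥ e) := by
  rw [twofold, twofold, conj_add, ← conj_vecMulVec]
  have h := conj_one hP
  simp only [conj, Matrix.mul_neg, Matrix.neg_mul, Matrix.mul_smul, Matrix.smul_mul] at h ⊢
  rw [h]

lemma crossProduct_mulVec_dotProduct (P : Mat3) (x y z : Vec3) :
    crossProduct (P *ᵥ x) (P *ᵥ y) ⬝ᵥ (P *ᵥ z) = P.det * (crossProduct x y ⬝ᵥ z) := by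
  simp only [cross_apply, mulVec, dotProduct, Fin.sum_univ_three, det_fin_three, cons_val]
  ring

lemma cof_conj {P : Mat3} (hP : P ∈ specialOrthogonalGroup (Fin 3) ℝ) (X : Mat3) :
    cof (conj P X) = conj P (cof X) := by
  have h1 : P.adjugate = Pᵀ := by
    have h := mul_adjugate P
    rw [(mem_rotation_iff.mp hP).2, one_smul] at h
    calc P.adjugate = Pᵀ * P * P.adjugate := by
          rw [transpose_mul_self_of_rotation hP, Matrix.one_mul]
      _ = Pᵀ := by rw [Matrix.mul_assoc, h, Matrix.mul_one]
  rw [cof, cof, conj, adjugate_mul_distrib, adjugate_mul_distrib, ← adjugate_transpose, h1, conj,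
    transpose_transpose]
  simp only [transpose_mul, transpose_transpose, Matrix.mul_assoc]

section transport
variable {P : Mat3} (hP : P ∈ specialOrthogonalGroup (Fin 3) ℝ)
include hP

lemma AusteniteVectors.conj {U V R : Mat3} {m aU aV : Vec3} (h : AusteniteVectors U V R m aU aV) :
    AusteniteVectors (conj P U) (conj P V) (conj P R) (P *ᵥ m) (P *ᵥ aU) (P *ᵥ aV) := by
  obtain ⟨RU, hRU, RV, hRV, h1, h2, h3⟩ := h
  refine ⟨_, conj_rotation hP hRU, _, conj_rotation hP hRV, ?_, ?_, ?_⟩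
  · rw [← conj_mul hP, h1, conj_add, conj_one hP, conj_vecMulVec]
  · rw [← conj_mul hP, h2, conj_add, conj_one hP, conj_vecMulVec]
  · rw [h3, conj_mul hP]

lemma StarRotations.conj {M : Set Mat3} (hM : ∀ X ∈ M, conj P X ∈ M) {U V : Mat3}
    {m aU aV : Vec3} {μ : ℝ} {n : ℕ} {Q : Fin n → Mat3} (h : StarRotations M U V m aU aV μ n Q) :
    StarRotations M (conj P U) (conj P V) (P *ᵥ m) (P *ᵥ aU) (P *ᵥ aV) μ n
      (fun i => conj P (Q i)) where
  rotation i := conj_rotation hP (h.rotation i)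
  ne_one i hi := h.ne_one i (conj_injective hP (hi.trans (conj_one hP).symm))
  distinct i j hij := h.distinct (conj_injective hP hij)
  t1 i := by
    rw [← conj_transpose, ← conj_mul hP, ← conj_mul hP, ← conj_mul hP, ← conj_mul hP]
    exact ⟨hM _ (h.t1 i).1, hM _ (h.t1 i).2⟩
  t2 i := by
    obtain ⟨χ, hχ, h2⟩ := h.t2 i
    refine ⟨χ, hχ, ?_⟩
    rw [← mulVec_smul, ← mulVec_smul, ← mulVec_add, conj_mulVec hP, h2, mulVec_smul]
  t3_pair i j hij := by
    rw [conj_mulVec hP, conj_mulVec hP, crossProduct_mulVec_dotProduct, (mem_rotation_iff.mp hP).2,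
      one_mul]
    exact h.t3_pair i j hij
  t3_triple i j k hij hik hjk := by
    rw [conj_mulVec hP, conj_mulVec hP, conj_mulVec hP, crossProduct_mulVec_dotProduct,
      (mem_rotation_iff.mp hP).2, one_mul]
    exact h.t3_triple i j k hij hik hjk

lemma HasStarRotations.conj {M : Set Mat3} (hM : ∀ X ∈ M, conj P X ∈ M) {U V R : Mat3} {m : Vec3}
    {n : ℕ} (h : HasStarRotations M U V R m n) :
    HasStarRotations M (conj P U) (conj P V) (conj P R) (P *ᵥ m) n := by
  obtain ⟨aU, aV, h1, μ, hμ, Q, h2⟩ := h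
  exact ⟨_, _, h1.conj hP, μ, hμ, _, h2.conj hP hM⟩

/-- Allows the twin to be moved by any symmetry of `M`; the converse is the forward direction
applied to `Pᵀ`, which is why invariance under both is assumed. -/
lemma hasStarRotations_conj_iff {M : Set Mat3} (hM : ∀ X ∈ M, conj P X ∈ M)
    (hM' : ∀ X ∈ M, StarTwin.conj Pᵀ X ∈ M) {U V R : Mat3} {m : Vec3} {n : ℕ} :
    HasStarRotations M (conj P U) (conj P V) (conj P R) (P *ᵥ m) n ↔
      HasStarRotations M U V R m n := by
  refine ⟨fun h => ?_, fun h => h.conj hP hM⟩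
  have h' := h.conj (rotation_transpose hP) hM'
  rwa [conj_transpose_conj hP, conj_transpose_conj hP, conj_transpose_conj hP,
    transpose_mulVec_mulVec hP] at h'

end transport

/-- The data of a type II twin with a given axis `e`, together with the second cofactor
condition. -/
structure TwinData (U V R : Mat3) (b m e : Vec3) : Prop where
  rotation : R ∈ specialOrthogonalGroup (Fin 3) ℝ
  compatible : R * V - U = vecMulVec b m
  unit : m ⬝ᵥ m = 1
  axis : IsTwinAxis U V e
  typeII : vecMulVec b m = vecMulVec (bII U e) (mII U e)
  cc2 : b ⬝ᵥ ((U * cof (U * U - 1)) *ᵥ m) = 0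

lemma TwinData.conj {P : Mat3} (hP : P ∈ specialOrthogonalGroup (Fin 3) ℝ) {U V R : Mat3}
    {b m e : Vec3} (h : TwinData U V R b m e) :
    TwinData (conj P U) (conj P V) (conj P R) (P *ᵥ b) (P *ᵥ m) (P *ᵥ e) where
  rotation := conj_rotation hP h.rotation
  compatible := by rw [← conj_mul hP, ← conj_sub, h.compatible, conj_vecMulVec]
  unit := by rw [dotProduct_rotation hP, h.unit]
  axis := by
    refine ⟨by rw [dotProduct_rotation hP, h.axis.1], ?_⟩
    rw [← conj_twofold hP, ← conj_mul hP, ← conj_mul hP, ← h.axis.2]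
  typeII := by
    have h1 : bII (StarTwin.conj P U) (P *ᵥ e) = P *ᵥ bII U e := by
      rw [bII, bII, conj_mulVec hP]
    have h2 : mII (StarTwin.conj P U) (P *ᵥ e) = P *ᵥ mII U e := by
      rw [mII, mII, ← conj_mul hP, conj_mulVec hP, conj_mulVec hP, dotProduct_rotation hP,
        mulVec_smul, mulVec_sub, mulVec_smul]
    rw [h1, h2, ← conj_vecMulVec, ← conj_vecMulVec, h.typeII]
  cc2 := by
    have h1 : StarTwin.conj P U * cof (StarTwin.conj P U * StarTwin.conj P U - 1) =
        StarTwin.conj P (U * cof (U * U - 1)) := by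
      rw [conj_mul hP, ← cof_conj hP, conj_sub, conj_mul hP, conj_one hP]
    rw [h1, conj_mulVec hP, dotProduct_rotation hP, h.cc2]

/-! ### Half-turns and uniqueness of the twin axis. -/

lemma vecMulVec_crossProduct_self (u e : Vec3) :
    vecMulVec (crossProduct u e) (crossProduct u e) =
      ((u ⬝ᵥ u) * (e ⬝ᵥ e) - (u ⬝ᵥ e) ^ 2) • (1 : Mat3) - (e ⬝ᵥ e) • vecMulVec u u -
        (u ⬝ᵥ u) • vecMulVec e e + (u ⬝ᵥ e) • (vecMulVec u e + vecMulVec e u) := by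
  ext i j
  fin_cases i <;> fin_cases j <;>
    simp [cross_apply, vecMulVec_apply, dotProduct, Fin.sum_univ_three] <;> ring

/-- For orthonormal `u`, `e` the projections onto `u`, `e` and `u × e` sum to the identity, so
half-turns about two perpendicular axes commute and compose to the half-turn about the third. -/
lemma twofold_crossProduct {u e : Vec3} (hu : u ⬝ᵥ u = 1) (he : e ⬝ᵥ e = 1) (hue : u ⬝ᵥ e = 0) :
    twofold (crossProduct u e) = twofold e * twofold u ∧
      twofold (crossProduct u e) = twofold u * twofold e := by
  have hue' : e ⬝ᵥ u = 0 := by rw [dotProduct_comm, hue]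
  have h := vecMulVec_crossProduct_self u e
  rw [hu, he, hue] at h
  simp only [twofold, h, Matrix.mul_add, Matrix.add_mul, Matrix.mul_smul, Matrix.smul_mul,
    vecMulVec_mul_vecMulVec, hue, hue', zero_smul, vecMulVec_zero, Matrix.mul_neg, Matrix.neg_mul, Matrix.mul_one,
    Matrix.one_mul]
  constructor <;> module

/-- By symmetry `w` is both a left and a right eigenvector, so the half-turn about `w`, an
involution, commutes with `U`. -/
lemma twofold_conj_of_eigenvector {U : Mat3} (hU : Uᵀ = U) {w : Vec3} (hw : w ⬝ᵥ w = 1) {κ : ℝ}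
    (h : U *ᵥ w = κ • w) : twofold w * U * twofold w = U := by
  have hwU : w ᵥ* U = κ • w := by rw [← h, ← vecMul_transpose, hU]
  have hww : twofold w * twofold w = 1 := by
    simp only [twofold, Matrix.mul_add, Matrix.add_mul, Matrix.mul_smul, Matrix.smul_mul,
      Matrix.mul_neg, Matrix.neg_mul, Matrix.mul_one, Matrix.one_mul, vecMulVec_mul_vecMulVec, hw,
      one_smul]
    module
  have hcomm : twofold w * U = U * twofold w := by
    simp only [twofold, Matrix.mul_add, Matrix.add_mul, Matrix.mul_smul, Matrix.smul_mul,
      Matrix.mul_neg, Matrix.neg_mul, Matrix.mul_one, Matrix.one_mul, vecMulVec_mul, mul_vecMulVec,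
      hwU, h, smul_vecMulVec, vecMulVec_smul]
  rw [hcomm, Matrix.mul_assoc, hww, Matrix.mul_one]

/-- If the twin axis is unique, then it is not orthogonal to any eigenvector. -/
lemma dotProduct_axis_ne_zero {U V : Mat3} (hU : Uᵀ = U) {e : Vec3} (he : IsTwinAxis U V e)
    (huniq : ∀ e' : Vec3, IsTwinAxis U V e' → e' = e ∨ e' = -e) {u : Vec3} (hu : u ≠ 0) {κ : ℝ}
    (h : U *ᵥ u = κ • u) : u ⬝ᵥ e ≠ 0 := by
  intro hue
  have hpos : 0 < u ⬝ᵥ u := by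
    have := dotProduct_star_self_pos_iff.mpr hu
    simpa using this
  set r := Real.sqrt (u ⬝ᵥ u) with hr
  have hr2 : r * r = u ⬝ᵥ u := Real.mul_self_sqrt hpos.le
  have hr0 : r ≠ 0 := (Real.sqrt_pos.mpr hpos).ne'
  set w : Vec3 := r⁻¹ • u with hw
  have hw1 : w ⬝ᵥ w = 1 := by
    rw [hw, smul_dotProduct, dotProduct_smul, ← hr2, smul_eq_mul, smul_eq_mul]
    field_simp
  have hwe : w ⬝ᵥ e = 0 := by rw [hw, smul_dotProduct, hue, smul_zero]
  have hUw : U *ᵥ w = κ • w := by rw [hw, mulVec_smul, h, smul_comm]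
  have hc := twofold_conj_of_eigenvector hU hw1 hUw
  obtain ⟨h1, h2⟩ := twofold_crossProduct hw1 he.1 hwe
  -- The competing axis: its half-turn is the one about `e` composed with the one about `w`, and the
  -- latter does not change `U`.
  have hax : IsTwinAxis U V (crossProduct w e) := by
    constructor
    · rw [cross_dot_cross, hw1, he.1, hwe]
      ring
    · rw [he.2]
      nth_rewrite 1 [h1]
      rw [h2]
      calc twofold e * U * twofold e = twofold e * (twofold w * U * twofold w) * twofold e := by
            rw [hc]
        _ = _ := by simp only [Matrix.mul_assoc]
  have hce : crossProduct w e ⬝ᵥ e = 0 := by rw [dotProduct_comm, dot_cross_self]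
  rcases huniq _ hax with h3 | h3 <;> rw [h3] at hce
  · rw [he.1] at hce
    exact one_ne_zero hce
  · rw [neg_dotProduct, he.1] at hce
    norm_num at hce

/-! ### Signed permutations, the cubic symmetry of the variants and their `d`-eigenspaces. -/

/-- Signed permutation matrices. -/
def IsSignedPerm (Q : Mat3) : Prop :=
  ∃ f : Fin 3 → Fin 3, Function.Injective f ∧ ∃ s : Fin 3 → ℝ, (∀ i, s i = 1 ∨ s i = -1) ∧
    ∀ i j, Q i j = if f i = j then s i else 0

lemma IsSignedPerm.transpose {Q : Mat3} (h : IsSignedPerm Q) : IsSignedPerm Qᵀ := by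
  obtain ⟨f, hf, s, hs, hQ⟩ := h
  obtain ⟨g, hg⟩ := (Finite.injective_iff_surjective.mp hf).hasRightInverse
  have hg' : ∀ i, g (f i) = i := fun i => hf (hg (f i))
  refine ⟨g, hg.injective, s ∘ g, fun i => hs (g i), fun i j => ?_⟩
  rw [transpose_apply, hQ]
  by_cases hij : f j = i
  · rw [if_pos hij, if_pos (by rw [← hij, hg']), Function.comp, ← hij, hg']
  · rw [if_neg hij, if_neg fun h' => hij (by rw [← h', hg])]

/-- The variant whose distinguished axis is the third coordinate axis. -/
def base (α β γ d : ℝ) : Mat3 := !![α, β, 0; β, γ, 0; 0, 0, d]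

/-- The position of the entry `d` on the diagonal of a variant. -/
def pos : Fin 12 → Fin 3 := ![2, 2, 2, 2, 1, 1, 1, 1, 0, 0, 0, 0]

/-- Reduces statements about the twelve variants to one about `base`: a variant is a relabelling of
the coordinates together with a sign of `b`. -/
lemma variant_eq_submatrix (a b c d : ℝ) (k : Fin 12) : ∃ σ : Equiv.Perm (Fin 3),
    ∃ β, (β = b ∨ β = -b) ∧ σ (pos k) = 2 ∧
      variant a b c d k = (base a β c d).submatrix σ σ := by
  have key : ∀ (k : Fin 12) (g : Fin 3 → Fin 3) (β : ℝ), Function.Injective g →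
      (β = b ∨ β = -b) → g (pos k) = 2 →
      (∀ i j, variant a b c d k i j = base a β c d (g i) (g j)) →
      ∃ σ : Equiv.Perm (Fin 3), ∃ β, (β = b ∨ β = -b) ∧ σ (pos k) = 2 ∧
        variant a b c d k = (base a β c d).submatrix σ σ :=
    fun k g β h1 h2 h3 h4 => ⟨Equiv.ofBijective g (Finite.injective_iff_bijective.mp h1), β, h2,
      h3, Matrix.ext h4⟩
  fin_cases k
  · refine key _ ![0, 1, 2] b (by decide) (by simp) rfl ?_
    intro i j
    fin_cases i <;> fin_cases j <;> rfl
  · refine key _ ![0, 1, 2] (-b) (by decide) (by simp) rfl ?_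
    intro i j
    fin_cases i <;> fin_cases j <;> rfl
  · refine key _ ![1, 0, 2] b (by decide) (by simp) rfl ?_
    intro i j
    fin_cases i <;> fin_cases j <;> rfl
  · refine key _ ![1, 0, 2] (-b) (by decide) (by simp) rfl ?_
    intro i j
    fin_cases i <;> fin_cases j <;> rfl
  · refine key _ ![0, 2, 1] b (by decide) (by simp) rfl ?_
    intro i j
    fin_cases i <;> fin_cases j <;> rfl
  · refine key _ ![0, 2, 1] (-b) (by decide) (by simp) rfl ?_
    intro i j
    fin_cases i <;> fin_cases j <;> rfl
  · refine key _ ![1, 2, 0] b (by decide) (by simp) rfl ?_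
    intro i j
    fin_cases i <;> fin_cases j <;> rfl
  · refine key _ ![1, 2, 0] (-b) (by decide) (by simp) rfl ?_
    intro i j
    fin_cases i <;> fin_cases j <;> rfl
  · refine key _ ![2, 0, 1] b (by decide) (by simp) rfl ?_
    intro i j
    fin_cases i <;> fin_cases j <;> rfl
  · refine key _ ![2, 0, 1] (-b) (by decide) (by simp) rfl ?_
    intro i j
    fin_cases i <;> fin_cases j <;> rfl
  · refine key _ ![2, 1, 0] b (by decide) (by simp) rfl ?_
    intro i j
    fin_cases i <;> fin_cases j <;> rfl
  · refine key _ ![2, 1, 0] (-b) (by decide) (by simp) rfl ?_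
    intro i j
    fin_cases i <;> fin_cases j <;> rfl

/-- Six relabellings and two signs account for exactly the twelve variants; in this form invariance
under signed permutations is visible. -/
lemma mem_range_variant_iff {a b c d : ℝ} {X : Mat3} :
    X ∈ Set.range (variant a b c d) ↔ ∃ g : Fin 3 → Fin 3, Function.Injective g ∧
      ∃ β, (β = b ∨ β = -b) ∧ ∀ i j, X i j = base a β c d (g i) (g j) := by
  constructor
  · rintro ⟨k, rfl⟩
    obtain ⟨σ, β, hβ, -, h⟩ := variant_eq_submatrix a b c d k
    exact ⟨σ, σ.injective, β, hβ, fun i j => by rw [h, submatrix_apply]⟩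
  · rintro ⟨g, hg, β, hβ, h⟩
    have h01 : g 0 ≠ g 1 := hg.ne (by decide)
    have h02 : g 0 ≠ g 2 := hg.ne (by decide)
    have h12 : g 1 ≠ g 2 := hg.ne (by decide)
    have hX : X = of ![![base a β c d (g 0) (g 0), base a β c d (g 0) (g 1),
        base a β c d (g 0) (g 2)], ![base a β c d (g 1) (g 0), base a β c d (g 1) (g 1),
        base a β c d (g 1) (g 2)], ![base a β c d (g 2) (g 0), base a β c d (g 2) (g 1),
        base a β c d (g 2) (g 2)]] := by
      ext i j
      rw [h]
      fin_cases i <;> fin_cases j <;> rfl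
    rw [hX]
    generalize g 0 = x at *
    generalize g 1 = y at *
    generalize g 2 = z at *
    rcases hβ with rfl | rfl
    · fin_cases x <;> fin_cases y <;> first | exact absurd rfl h01 | skip
      all_goals fin_cases z
      all_goals first | exact absurd rfl h02 | exact absurd rfl h12 | skip
      · exact ⟨0, rfl⟩
      · exact ⟨4, rfl⟩
      · exact ⟨2, rfl⟩
      · exact ⟨6, rfl⟩
      · exact ⟨8, rfl⟩
      · exact ⟨10, rfl⟩
    · fin_cases x <;> fin_cases y <;> first | exact absurd rfl h01 | skip
      all_goals fin_cases z
      all_goals first | exact absurd rfl h02 | exact absurd rfl h12 | skip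
      · exact ⟨1, rfl⟩
      · exact ⟨5, rfl⟩
      · exact ⟨3, rfl⟩
      · exact ⟨7, rfl⟩
      · exact ⟨9, rfl⟩
      · exact ⟨11, rfl⟩

/-- The set of variants is invariant under the cubic group. -/
lemma IsSignedPerm.conj_mem {Q : Mat3} (h : IsSignedPerm Q) {a b c d : ℝ} {X : Mat3}
    (hX : X ∈ Set.range (variant a b c d)) : conj Q X ∈ Set.range (variant a b c d) := by
  obtain ⟨f, hf, s, hs, hQ⟩ := h
  rw [mem_range_variant_iff] at hX ⊢
  obtain ⟨g, hg, β, hβ, hX⟩ := hX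
  have hconj : ∀ i j, conj Q X i j = s i * s j * X (f i) (f j) := by
    intro i j
    simp only [conj, mul_apply, transpose_apply, hQ, ite_mul, zero_mul, mul_ite, mul_zero,
      Finset.sum_ite_eq, Finset.mem_univ, if_true]
    ring
  have hgf : Function.Injective (g ∘ f) := hg.comp hf
  obtain ⟨k, hk⟩ := (Finite.injective_iff_surjective.mp hgf).hasRightInverse
  -- The only off-diagonal entry of `base` couples the indices `0` and `1`, so just the signs at
  -- their preimages under `g ∘ f` survive; on the diagonal signs are squared.
  refine ⟨g ∘ f, hgf, s (k 0) * s (k 1) * β, ?_, ?_⟩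
  · rcases hs (k 0) with h0 | h0 <;> rcases hs (k 1) with h1 | h1 <;> rw [h0, h1] <;>
      rcases hβ with rfl | rfl <;> simp
  · intro i j
    have hkk : ∀ i, i = k ((g ∘ f) i) := fun i => hgf (hk _).symm
    have hss : ∀ i, s i * s i = 1 := fun i => by rcases hs i with h | h <;> rw [h] <;> norm_num
    rw [hconj, hX]
    change s i * s j * base a β c d ((g ∘ f) i) ((g ∘ f) j) = _
    have e1 : s i = s (k ((g ∘ f) i)) := by rw [← hkk]
    have e2 : s j = s (k ((g ∘ f) j)) := by rw [← hkk]
    rw [e1, e2]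
    generalize (g ∘ f) i = x
    generalize (g ∘ f) j = y
    fin_cases x <;> fin_cases y <;> simp [base, hss, mul_comm (s (k 1))]

lemma base_transpose (α β γ d : ℝ) : (base α β γ d)ᵀ = base α β γ d := by
  ext i j
  fin_cases i <;> fin_cases j <;> rfl

lemma base_mulVec (α β γ d : ℝ) (x : Vec3) :
    base α β γ d *ᵥ x = ![α * x 0 + β * x 1, β * x 0 + γ * x 1, d * x 2] := by
  ext i
  fin_cases i <;> simp [base, mulVec, dotProduct, Fin.sum_univ_three]

lemma variant_transpose (a b c d : ℝ) (k : Fin 12) :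
    (variant a b c d k)ᵀ = variant a b c d k := by
  obtain ⟨σ, β, -, -, h⟩ := variant_eq_submatrix a b c d k
  rw [h, transpose_submatrix, base_transpose]

/-- The hypothesis `hδ` says that `d` is not an eigenvalue of the 2 × 2 block, so the `d`-eigenspace
is a coordinate axis. -/
lemma eq_zero_of_eigenvector {a b c d : ℝ} (hδ : (a - d) * (c - d) - b ^ 2 ≠ 0) {k : Fin 12}
    {f : Vec3} (h : variant a b c d k *ᵥ f = d • f) {i : Fin 3} (hi : i ≠ pos k) : f i = 0 := by
  obtain ⟨σ, β, hβ, hσ, hk⟩ := variant_eq_submatrix a b c d k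
  have hβ2 : β ^ 2 = b ^ 2 := by rcases hβ with rfl | rfl <;> ring
  rw [hk, submatrix_mulVec_equiv, base_mulVec] at h
  have h0 := congrFun h (σ.symm 0)
  have h1 := congrFun h (σ.symm 1)
  simp only [Function.comp, Equiv.apply_symm_apply, cons_val, Pi.smul_apply, smul_eq_mul] at h0 h1
  have hx : f (σ.symm 0) = 0 := by
    refine (mul_eq_zero.mp ?_).resolve_left hδ
    rw [← hβ2]
    linear_combination (c - d) * h0 - β * h1
  have hy : f (σ.symm 1) = 0 := by
    refine (mul_eq_zero.mp ?_).resolve_left hδ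
    rw [← hβ2]
    linear_combination (a - d) * h1 - β * h0
  have hi' : σ i ≠ 2 := fun h' => hi (σ.injective (h'.trans hσ.symm))
  have h01 : σ i = 0 ∨ σ i = 1 := by omega
  rcases h01 with h' | h'
  · rwa [← h', Equiv.symm_apply_apply] at hx
  · rwa [← h', Equiv.symm_apply_apply] at hy

lemma exists_eigenvector {a b c d : ℝ} (hb : b ≠ 0) (hδ : (a - d) * (c - d) - b ^ 2 = 0)
    (k : Fin 12) : ∃ w : Vec3, w ≠ 0 ∧ w (pos k) = 0 ∧ variant a b c d k *ᵥ w = d • w := by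
  obtain ⟨σ, β, hβ, hσ, hk⟩ := variant_eq_submatrix a b c d k
  have hβ2 : β ^ 2 = b ^ 2 := by rcases hβ with rfl | rfl <;> ring
  have hβ0 : β ≠ 0 := by rcases hβ with rfl | rfl <;> simpa
  -- A kernel vector of the singular block minus `d`, read off from its first row.
  refine ⟨![β, d - a, 0] ∘ σ, fun h => hβ0 ?_, ?_, ?_⟩
  · simpa using congrFun h (σ.symm 0)
  · rw [Function.comp, hσ]
    rfl
  · have h0 : base a β c d *ᵥ ![β, d - a, 0] = d • ![β, d - a, 0] := by
      rw [base_mulVec]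
      ext i
      fin_cases i <;> simp
      · ring
      · linear_combination hβ2 - hδ
    rw [hk, submatrix_mulVec_equiv, Function.comp_assoc, Equiv.self_comp_symm, Function.comp_id, h0]
    rfl

lemma variant_mulVec_single (a b c d : ℝ) (k : Fin 12) :
    variant a b c d k *ᵥ Pi.single (pos k) 1 = d • Pi.single (pos k) 1 := by
  obtain ⟨σ, β, -, hσ, hk⟩ := variant_eq_submatrix a b c d k
  have h : (Pi.single (pos k) 1 : Vec3) ∘ σ.symm = Pi.single 2 1 := by
    ext i
    simp only [Function.comp, Pi.single_apply, ← hσ, Equiv.symm_apply_eq]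
  have h' : (Pi.single (pos k) 1 : Vec3) = Pi.single 2 1 ∘ σ := by
    rw [← h, Function.comp_assoc, Equiv.symm_comp_self, Function.comp_id]
  have h0 : base a β c d *ᵥ Pi.single 2 1 = d • Pi.single 2 1 := by
    rw [base_mulVec]
    ext i
    fin_cases i <;> simp
  rw [hk, submatrix_mulVec_equiv, h, h0, h']
  rfl

/-! ### The twin axis is a face diagonal. -/

section axis
variable {a b c d : ℝ} {i j : Fin 12} {e : Vec3}

/-- If the twin axis is unique, then `d` is a simple eigenvalue. -/
lemma simple_of_unique_axis (hb : b ≠ 0)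
    (he : IsTwinAxis (variant a b c d i) (variant a b c d j) e)
    (huniq : ∀ e' : Vec3, IsTwinAxis (variant a b c d i) (variant a b c d j) e' →
      e' = e ∨ e' = -e) : (a - d) * (c - d) - b ^ 2 ≠ 0 := by
  intro hδ
  obtain ⟨w, hw0, hwp, hw⟩ := exists_eigenvector hb hδ i
  have hp := variant_mulVec_single a b c d i
  set p : Vec3 := Pi.single (pos i) 1 with hpdef
  have hp0 : p ≠ 0 := by
    intro h
    have := congrFun h (pos i)
    simp [hpdef] at this
  have hpe := dotProduct_axis_ne_zero (variant_transpose a b c d i) he huniq hp0 hp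
  -- If `d` were a double eigenvalue, its eigenspace would meet the plane orthogonal to `e`; this is
  -- the vector in the intersection.
  set u : Vec3 := (w ⬝ᵥ e) • p - (p ⬝ᵥ e) • w with hu
  have hu0 : u ≠ 0 := by
    intro h
    have h1 : w ⬝ᵥ e = 0 := by
      have := congrFun h (pos i)
      simpa [hu, hwp, hpdef] using this
    rw [hu, h1, zero_smul, zero_sub, neg_eq_zero, smul_eq_zero] at h
    exact h.elim hpe hw0
  refine dotProduct_axis_ne_zero (variant_transpose a b c d i) he huniq hu0 (κ := d) ?_ ?_
  · rw [hu, mulVec_sub, mulVec_smul, mulVec_smul, hp, hw, smul_sub, smul_comm d, smul_comm d]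
  · rw [hu, sub_dotProduct, smul_dotProduct, smul_dotProduct, smul_eq_mul, smul_eq_mul]
    ring

lemma twofold_mulVec (e x : Vec3) : twofold e *ᵥ x = -x + (2 * (e ⬝ᵥ x)) • e := by
  rw [twofold, add_mulVec, neg_mulVec, one_mulVec, smul_mulVec, vecMulVec_mulVec]
  ext i
  simp
  ring

lemma twofold_mul_twofold {e : Vec3} (he : e ⬝ᵥ e = 1) : twofold e * twofold e = 1 := by
  simp only [twofold, Matrix.mul_add, Matrix.add_mul, Matrix.mul_smul, Matrix.smul_mul,
    Matrix.mul_neg, Matrix.neg_mul, Matrix.mul_one, Matrix.one_mul, vecMulVec_mul_vecMulVec, he,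
    one_smul]
  module

/-- A unique twin axis of two different variants is a diagonal of a face of the cube. -/
lemma axis_of_unique_axis (hb : b ≠ 0) (hne : variant a b c d i ≠ variant a b c d j)
    (he : IsTwinAxis (variant a b c d i) (variant a b c d j) e)
    (huniq : ∀ e' : Vec3, IsTwinAxis (variant a b c d i) (variant a b c d j) e' →
      e' = e ∨ e' = -e) :
    pos i ≠ pos j ∧ e (pos i) ^ 2 = 1 / 2 ∧ e (pos j) ^ 2 = 1 / 2 ∧
      ∀ k, k ≠ pos i → k ≠ pos j → e k = 0 := by
  have hδ := simple_of_unique_axis hb he huniq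
  have hp := variant_mulVec_single a b c d i
  set p : Vec3 := Pi.single (pos i) 1 with hpdef
  have hp0 : p ≠ 0 := by
    intro h
    have := congrFun h (pos i)
    simp [hpdef] at this
  have hpe := dotProduct_axis_ne_zero (variant_transpose a b c d i) he huniq hp0 hp
  have hpe' : p ⬝ᵥ e = e (pos i) := by rw [hpdef, single_one_dotProduct]
  rw [hpe'] at hpe
  -- The half-turn about `e` carries the `d`-eigenline of the first variant to that of the second.
  -- Both are coordinate axes, which leaves few possibilities for `e`.
  have hf : variant a b c d j *ᵥ (twofold e *ᵥ p) = d • (twofold e *ᵥ p) := by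
    rw [he.2, mulVec_mulVec, Matrix.mul_assoc, Matrix.mul_assoc, twofold_mul_twofold he.1,
      Matrix.mul_one, ← mulVec_mulVec, hp, mulVec_smul]
  have hz : ∀ k, k ≠ pos j → -p k + 2 * e (pos i) * e k = 0 := by
    intro k hk
    have := eq_zero_of_eigenvector hδ hf hk
    rw [twofold_mulVec, dotProduct_comm, hpe'] at this
    simpa using this
  have hpk : ∀ k, k ≠ pos i → p k = 0 := fun k hk => by rw [hpdef, Pi.single_eq_of_ne hk]
  have hpp : p (pos i) = 1 := by rw [hpdef, Pi.single_eq_same]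
  have hoff : ∀ k, k ≠ pos i → k ≠ pos j → e k = 0 := by
    intro k hk hk'
    have := hz k hk'
    rw [hpk k hk] at this
    have h2 : e (pos i) * e k = 0 := by linarith
    exact (mul_eq_zero.mp h2).resolve_left hpe
  have hee := he.1
  have hij : pos i ≠ pos j := by
    intro hij
    apply hne
    -- With a common distinguished axis, `e` would be an eigenvector and the two variants would
    -- coincide.
    have hep : e = e (pos i) • p := by
      ext k
      by_cases hk : k = pos i
      · rw [hk, Pi.smul_apply, hpp, smul_eq_mul, mul_one]
      · rw [hoff k hk (hij ▸ hk), Pi.smul_apply, hpk k hk, smul_zero]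
    rw [he.2]
    refine (twofold_conj_of_eigenvector (variant_transpose a b c d i) hee (κ := d) ?_).symm
    rw [hep, mulVec_smul, hp, smul_comm]
  have h1 : e (pos i) ^ 2 = 1 / 2 := by
    have := hz _ hij
    rw [hpp] at this
    linarith
  refine ⟨hij, h1, ?_, hoff⟩
  have hsum : e ⬝ᵥ e = e (pos i) ^ 2 + e (pos j) ^ 2 := by
    rw [dotProduct, ← Finset.sum_subset (Finset.subset_univ {pos i, pos j}),
      Finset.sum_pair hij, sq, sq]
    intro k _ hk
    simp only [Finset.mem_insert, Finset.mem_singleton, not_or] at hk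
    rw [hoff k hk.1 hk.2, zero_mul]
  linarith

end axis

/-! ### Cubic rotations. -/

/-- A cubic rotation that carries two given coordinate axes to the third and the second one. -/
lemma exists_cubic_rotation {p q : Fin 3} (hpq : p ≠ q) {ε : ℝ} (hε : ε = 1 ∨ ε = -1) :
    ∃ P : Mat3, P ∈ specialOrthogonalGroup (Fin 3) ℝ ∧ IsSignedPerm P ∧
      ∀ x : Vec3, (P *ᵥ x) 2 = x p ∧ (P *ᵥ x) 1 = ε * x q ∧
        ∃ k s, k ≠ p ∧ k ≠ q ∧ (P *ᵥ x) 0 = s * x k := by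
  -- The row signs multiply to `σ`, so `σ` has to be the parity of the permutation for the
  -- determinant to be `1`.
  have key : ∀ (f : Fin 3 → Fin 3) (σ : ℝ), Function.Injective f → f 2 = p → f 1 = q →
      (σ = 1 ∨ σ = -1) → (of fun i j => if f i = j then ![σ * ε, ε, 1] i else 0 : Mat3).det = 1 →
      ∃ P : Mat3, P ∈ specialOrthogonalGroup (Fin 3) ℝ ∧ IsSignedPerm P ∧
      ∀ x : Vec3, (P *ᵥ x) 2 = x p ∧ (P *ᵥ x) 1 = ε * x q ∧
        ∃ k s, k ≠ p ∧ k ≠ q ∧ (P *ᵥ x) 0 = s * x k := by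
    intro f σ hf hp hq hσ hdet
    have hs : ∀ i, (![σ * ε, ε, 1] : Vec3) i = 1 ∨ (![σ * ε, ε, 1] : Vec3) i = -1 := by
      intro i
      rcases hσ with rfl | rfl <;> rcases hε with rfl | rfl <;> fin_cases i <;> simp
    refine ⟨_, mem_rotation_iff.mpr ⟨?_, hdet⟩, ⟨f, hf, _, hs, fun i j => rfl⟩, fun x => ?_⟩
    · ext i j
      simp only [mul_apply, transpose_apply, of_apply, ite_mul, zero_mul,
        mul_ite, mul_zero, Finset.sum_ite_eq, Finset.mem_univ, if_true]
      by_cases hij : i = j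
      · rw [hij, one_apply_eq, if_pos rfl]
        rcases hs j with h | h <;> rw [h] <;> norm_num
      · rw [one_apply_ne hij, if_neg fun h => hij (hf h)]
    · have hx : ∀ i, ((of fun i j => if f i = j then ![σ * ε, ε, 1] i else 0 : Mat3) *ᵥ x) i =
          ![σ * ε, ε, 1] i * x (f i) := by
        intro i
        simp only [mulVec, dotProduct, of_apply, ite_mul, zero_mul, Finset.sum_ite_eq,
          Finset.mem_univ, if_true]
      refine ⟨?_, ?_, f 0, σ * ε, ?_, ?_, ?_⟩
      · rw [hx, hp]
        simp
      · rw [hx, hq]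
        simp
      · rw [← hp]
        exact hf.ne (by decide)
      · rw [← hq]
        exact hf.ne (by decide)
      · rw [hx]
        simp
  have hεε : ε * ε = 1 := by rcases hε with h | h <;> rw [h] <;> norm_num
  fin_cases p <;> fin_cases q <;> first | exact absurd rfl hpq | skip
  · refine key ![2, 1, 0] (-1) (by decide) rfl rfl (by simp) ?_
    simp [det_fin_three, hεε]
  · refine key ![1, 2, 0] 1 (by decide) rfl rfl (by simp) ?_
    simp [det_fin_three, hεε]
  · refine key ![2, 0, 1] 1 (by decide) rfl rfl (by simp) ?_
    simp [det_fin_three, hεε]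
  · refine key ![0, 2, 1] (-1) (by decide) rfl rfl (by simp) ?_
    simp [det_fin_three, hεε]
  · refine key ![1, 0, 2] (-1) (by decide) rfl rfl (by simp) ?_
    simp [det_fin_three, hεε]
  · refine key ![0, 1, 2] 1 (by decide) rfl rfl (by simp) ?_
    simp [det_fin_three, hεε]

/-- A rotation that conjugates two variants with different distinguished axes to variants is
a signed permutation. -/
lemma isSignedPerm_of_conj_mem {a b c d : ℝ} (hδ : (a - d) * (c - d) - b ^ 2 ≠ 0) {Q U V : Mat3}
    (hQ : Q ∈ specialOrthogonalGroup (Fin 3) ℝ)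
    (hU : U *ᵥ Pi.single 2 1 = d • Pi.single 2 1) (hV : V *ᵥ Pi.single 1 1 = d • Pi.single 1 1)
    (h1 : conj Q U ∈ Set.range (variant a b c d)) (h2 : conj Q V ∈ Set.range (variant a b c d)) :
    IsSignedPerm Q := by
  -- Conjugation moves a `d`-eigenvector to a `d`-eigenvector of a variant, hence a coordinate axis
  -- to a coordinate axis: column `n` of `Q` has a single nonzero entry.
  have key : ∀ (X : Mat3) (n : Fin 3), X *ᵥ Pi.single n 1 = d • Pi.single n 1 →
      conj Q X ∈ Set.range (variant a b c d) → ∃ p, ∀ i, i ≠ p → Q i n = 0 := by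
    rintro X n hX ⟨k, hk⟩
    refine ⟨pos k, fun i hi => ?_⟩
    have h3 : variant a b c d k *ᵥ (Q *ᵥ Pi.single n 1) = d • (Q *ᵥ Pi.single n 1) := by
      rw [hk, conj_mulVec hQ, hX, mulVec_smul]
    have := eq_zero_of_eigenvector hδ h3 hi
    rwa [mulVec_single_one] at this
  obtain ⟨p, hp⟩ := key U 2 hU h1
  obtain ⟨q, hq⟩ := key V 1 hV h2
  have hcol : ∀ n n', Q 0 n * Q 0 n' + Q 1 n * Q 1 n' + Q 2 n * Q 2 n' = (1 : Mat3) n n' := by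
    intro n n'
    rw [← transpose_mul_self_of_rotation hQ, mul_apply, Fin.sum_univ_three]
    rfl
  have hrow : ∀ n n', Q n 0 * Q n' 0 + Q n 1 * Q n' 1 + Q n 2 * Q n' 2 = (1 : Mat3) n n' := by
    intro n n'
    rw [← (mem_rotation_iff.mp hQ).1, mul_apply, Fin.sum_univ_three]
    rfl
  have single : ∀ (n p : Fin 3), (∀ i, i ≠ p → Q i n = 0) → Q p n ^ 2 = 1 := by
    intro n p h
    have := hcol n n
    rw [one_apply_eq] at this
    fin_cases p
    · rw [h 1 (by decide), h 2 (by decide)] at this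
      exact (by linarith : Q 0 n ^ 2 = 1)
    · rw [h 0 (by decide), h 2 (by decide)] at this
      exact (by linarith : Q 1 n ^ 2 = 1)
    · rw [h 0 (by decide), h 1 (by decide)] at this
      exact (by linarith : Q 2 n ^ 2 = 1)
  have hp1 := single 2 p hp
  have hq1 := single 1 q hq
  -- Otherwise row `p` would have two entries of modulus `1`.
  have hpq : p ≠ q := by
    rintro rfl
    have := hrow p p
    rw [one_apply_eq] at this
    nlinarith [sq_nonneg (Q p 0)]
  have hzero : ∀ i, i = p ∨ i = q → Q i 0 = 0 := by
    intro i hi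
    have := hrow i i
    rw [one_apply_eq] at this
    rcases hi with rfl | rfl
    · nlinarith [sq_nonneg (Q i 0), sq_nonneg (Q i 1)]
    · nlinarith [sq_nonneg (Q i 0), sq_nonneg (Q i 2)]
  obtain ⟨r, hrp, hrq⟩ : ∃ r, r ≠ p ∧ r ≠ q := by
    clear * -
    revert p q
    decide
  have hr : ∀ i, i ≠ r → Q i 0 = 0 := by
    intro i hi
    apply hzero
    clear * - hi hrp hrq hpq
    revert i r p q
    decide
  have hr1 := single 0 r hr
  have hsign : ∀ x : ℝ, x ^ 2 = 1 → x = 1 ∨ x = -1 := fun x hx => sq_eq_one_iff.mp hx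
  have : IsSignedPerm Qᵀ := by
    refine ⟨![r, q, p], ?_, ![Q r 0, Q q 1, Q p 2], ?_, ?_⟩
    · clear * - hrp hrq hpq
      revert r p q
      decide
    · intro i
      fin_cases i
      exacts [hsign _ hr1, hsign _ hq1, hsign _ hp1]
    · intro i j
      rw [transpose_apply]
      split_ifs with h
      · subst h
        fin_cases i <;> rfl
      · fin_cases i
        exacts [hr _ (Ne.symm h), hq _ (Ne.symm h), hp _ (Ne.symm h)]
  simpa using this.transpose

/-! ### Cubic rotations that preserve a line: necessary conditions. -/

lemma crossProduct_dotProduct_eq_zero {x y z N : Vec3} (hN : N ≠ 0) (hx : x ⬝ᵥ N = 0)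
    (hy : y ⬝ᵥ N = 0) (hz : z ⬝ᵥ N = 0) : crossProduct x y ⬝ᵥ z = 0 := by
  have h : (crossProduct x y ⬝ᵥ z) • N = (x ⬝ᵥ N) • crossProduct y z +
      (y ⬝ᵥ N) • crossProduct z x + (z ⬝ᵥ N) • crossProduct x y := by
    ext i
    fin_cases i <;> simp [cross_apply, dotProduct, Fin.sum_univ_three] <;> ring
  rw [hx, hy, hz, zero_smul, zero_smul, zero_smul, add_zero, add_zero, smul_eq_zero] at h
  exact h.resolve_right hN

/-- Distinct cubic rotations `Q 0, …, Q (n-1)`, different from the identity, that preserve the line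
of `A` and for which any three of `m, Q 0 m, …, Q (n-1) m` are linearly independent. -/
structure CubicStar (m A : Vec3) (n : ℕ) (Q : Fin n → Mat3) : Prop where
  det : ∀ i, (Q i).det = 1
  signedPerm : ∀ i, IsSignedPerm (Q i)
  ne_one : ∀ i, Q i ≠ 1
  distinct : Function.Injective Q
  t2 : ∀ i, ∃ χ : ℝ, (χ = 1 ∨ χ = -1) ∧ Q i *ᵥ A = χ • A
  t3_pair : ∀ i j, i ≠ j → crossProduct (Q i *ᵥ m) (Q j *ᵥ m) ⬝ᵥ m ≠ 0
  t3_triple : ∀ i j k, i ≠ j → i ≠ k → j ≠ k →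
    crossProduct (Q i *ᵥ m) (Q j *ᵥ m) ⬝ᵥ (Q k *ᵥ m) ≠ 0

lemma IsSignedPerm.mul_transpose {Q : Mat3} (h : IsSignedPerm Q) : Q * Qᵀ = 1 := by
  obtain ⟨f, hf, s, hs, hQ⟩ := h
  ext i j
  simp only [mul_apply, transpose_apply, hQ, ite_mul, zero_mul, mul_ite, mul_zero,
    Finset.sum_ite_eq, Finset.mem_univ, if_true]
  by_cases hij : i = j
  · rw [hij, one_apply_eq, if_pos rfl]
    rcases hs j with h | h <;> rw [h] <;> norm_num
  · rw [one_apply_ne hij, if_neg fun h => hij (hf h)]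

lemma CubicStar.rotation {m A : Vec3} {n : ℕ} {Q : Fin n → Mat3} (h : CubicStar m A n Q)
    (i : Fin n) : Q i ∈ specialOrthogonalGroup (Fin 3) ℝ :=
  mem_rotation_iff.mpr ⟨(h.signedPerm i).mul_transpose, h.det i⟩

lemma CubicStar.restrict {m A : Vec3} {Q : Fin 3 → Mat3} (h : CubicStar m A 3 Q) :
    CubicStar m A 2 (Q ∘ Fin.castSucc) where
  det _ := h.det _
  signedPerm _ := h.signedPerm _
  ne_one _ := h.ne_one _
  distinct := h.distinct.comp (Fin.castSucc_injective _)
  t2 _ := h.t2 _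
  t3_pair _ _ hij := h.t3_pair _ _ ((Fin.castSucc_injective _).ne hij)
  t3_triple _ _ _ h1 h2 h3 := h.t3_triple _ _ _ ((Fin.castSucc_injective _).ne h1)
    ((Fin.castSucc_injective _).ne h2) ((Fin.castSucc_injective _).ne h3)

/-- No vector that is orthogonal to `m` spans a line that is preserved by all `Q i`. -/
lemma CubicStar.dotProduct_ne_zero {m A : Vec3} {Q : Fin 2 → Mat3} (h : CubicStar m A 2 Q)
    {N : Vec3} (hN : N ≠ 0)
    (hQ : ∀ i, ∃ χ : ℝ, (χ = 1 ∨ χ = -1) ∧ Q i *ᵥ N = χ • N) : m ⬝ᵥ N ≠ 0 := by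
  intro hm
  -- A rotation that preserves the line of `N` preserves its orthogonal plane, so `m` and all its
  -- images would be coplanar.
  have key : ∀ i, (Q i *ᵥ m) ⬝ᵥ N = 0 := by
    intro i
    obtain ⟨χ, hχ, h1⟩ := hQ i
    have h2 := dotProduct_rotation (h.rotation i) m N
    rw [h1, hm, dotProduct_smul, smul_eq_mul] at h2
    rcases hχ with rfl | rfl <;> linarith
  exact h.t3_pair 0 1 (by decide) (crossProduct_dotProduct_eq_zero hN (key 0) (key 1) hm)

/-- The action of a signed permutation. -/
lemma IsSignedPerm.mulVec_apply {Q : Mat3} {f : Fin 3 → Fin 3} {s : Fin 3 → ℝ}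
    (hQ : ∀ i j, Q i j = if f i = j then s i else 0) (x : Vec3) (i : Fin 3) :
    (Q *ᵥ x) i = s i * x (f i) := by
  simp only [mulVec, dotProduct, hQ, ite_mul, zero_mul, Finset.sum_ite_eq, Finset.mem_univ, if_true]

lemma injective_fin_three_cases {f : Fin 3 → Fin 3} (hf : Function.Injective f) :
    (f 0 = 0 ∧ f 1 = 1 ∧ f 2 = 2) ∨ (f 0 = 0 ∧ f 1 = 2 ∧ f 2 = 1) ∨
    (f 0 = 1 ∧ f 1 = 0 ∧ f 2 = 2) ∨ (f 0 = 2 ∧ f 1 = 1 ∧ f 2 = 0) ∨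
    (f 0 = 1 ∧ f 1 = 2 ∧ f 2 = 0) ∨ (f 0 = 2 ∧ f 1 = 0 ∧ f 2 = 1) := by
  have h01 : f 0 ≠ f 1 := hf.ne (by decide)
  have h02 : f 0 ≠ f 2 := hf.ne (by decide)
  have h12 : f 1 ≠ f 2 := hf.ne (by decide)
  omega

/-- The possible rotations for the vectors `(u, v, -v)` and `(x, y, z)`. -/
lemma cubic_rotation_cases {Q : Mat3} (hP : IsSignedPerm Q) (hdet : Q.det = 1) (h1 : Q ≠ 1)
    {u v x y z χ : ℝ} (hx : x ≠ 0) (hyz : y ≠ z) (hχ : χ = 1 ∨ χ = -1)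
    (h : Q *ᵥ ![x, y, z] = χ • ![x, y, z])
    (hm : Q *ᵥ ![u, v, -v] ≠ ![u, v, -v] ∧ Q *ᵥ ![u, v, -v] ≠ -![u, v, -v]) :
    (y = 0 ∧ Q = !![-1, 0, 0; 0, 1, 0; 0, 0, -1]) ∨
    (z = 0 ∧ Q = !![-1, 0, 0; 0, -1, 0; 0, 0, 1]) ∨
    (y ^ 2 = x ^ 2 ∧ (z = 0 ∨ Q = !![0, -(y / x), 0; -(y / x), 0, 0; 0, 0, -1])) ∨
    (z ^ 2 = x ^ 2 ∧ (y = 0 ∨ Q = !![0, 0, -(z / x); 0, -1, 0; -(z / x), 0, 0])) ∨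
    (y ^ 2 = x ^ 2 ∧ z ^ 2 = x ^ 2) := by
  obtain ⟨f, hf, s, hs, hQ⟩ := hP
  have h0 := congrFun h 0
  have h1' := congrFun h 1
  have h2 := congrFun h 2
  rw [IsSignedPerm.mulVec_apply hQ] at h0 h1' h2
  have hχ2 : χ ^ 2 = 1 := by rcases hχ with rfl | rfl <;> norm_num
  have hss : ∀ i, s i ^ 2 = 1 := fun i => by rcases hs i with h | h <;> rw [h] <;> norm_num
  have hdet' := hdet
  rw [det_fin_three] at hdet'
  simp only [hQ] at hdet'
  have hm0 := IsSignedPerm.mulVec_apply hQ ![u, v, -v]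
  have hQe : Q = !![Q 0 0, Q 0 1, Q 0 2; Q 1 0, Q 1 1, Q 1 2; Q 2 0, Q 2 1, Q 2 2] :=
    eta_fin_three Q
  simp only [hQ] at hQe
  rcases injective_fin_three_cases hf with ⟨f0, f1, f2⟩ | ⟨f0, f1, f2⟩ | ⟨f0, f1, f2⟩ |
      ⟨f0, f1, f2⟩ | ⟨f0, f1, f2⟩ | ⟨f0, f1, f2⟩ <;>
    simp [f0, f1, f2] at h0 h1' h2 hdet' hQe
  · have e0 : s 0 = χ := by simpa [hx] using h0
    rw [e0] at hdet' hQe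
    by_cases hy : y = 0
    · have hz : z ≠ 0 := fun hz => hyz (hy.trans hz.symm)
      have e2 : s 2 = χ := by simpa [hz] using h2
      have e1 : s 1 = 1 := by rw [e2] at hdet'; linear_combination hdet' - s 1 * hχ2
      rw [e1, e2] at hQe
      rcases hχ with rfl | rfl
      · exact absurd (hQe.trans one_fin_three.symm) h1
      · exact Or.inl ⟨hy, hQe⟩
    · have e1 : s 1 = χ := by simpa [hy] using h1'
      have e2 : s 2 = 1 := by rw [e1] at hdet'; linear_combination hdet' - s 2 * hχ2
      rw [e1, e2] at hQe
      rcases hχ with rfl | rfl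
      · exact absurd (hQe.trans one_fin_three.symm) h1
      · refine Or.inr (Or.inl ⟨?_, hQe⟩)
        rw [e2] at h2
        norm_num at h2
        exact h2
  -- Swapping the last two coordinates forces `z = -y` and signs `χ, -χ, -χ`. Such a rotation maps
  -- `(u, v, -v)` to `χ` times itself, which `hm` excludes.
  · exfalso
    have e0 : s 0 = χ := by simpa [hx] using h0
    have hsq : y ^ 2 = z ^ 2 := by
      have : (s 1 * z) ^ 2 = (χ * y) ^ 2 := by rw [h1']
      rw [mul_pow, mul_pow, hss, hχ2] at this
      linarith
    have hzy : z = -y := by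
      rcases sq_eq_sq_iff_eq_or_eq_neg.mp hsq with h | h
      · exact absurd h hyz
      · linarith
    have hy : y ≠ 0 := fun h => hyz (by rw [hzy, h, neg_zero])
    have e1 : s 1 = -χ := by
      rw [hzy] at h1'
      exact mul_right_cancel₀ hy (by linarith)
    have e2 : s 2 = -χ := by
      rw [hzy] at h2
      exact mul_right_cancel₀ hy (by linarith)
    have hQm : Q *ᵥ ![u, v, -v] = χ • ![u, v, -v] := by
      ext i
      rw [hm0]
      fin_cases i <;> simp [f0, f1, f2, e0, e1, e2]
    rcases hχ with rfl | rfl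
    · exact hm.1 (by rw [hQm, one_smul])
    · exact hm.2 (by rw [hQm, neg_one_smul])
  · right; right; left
    have hsq : y ^ 2 = x ^ 2 := by
      have : (s 0 * y) ^ 2 = (χ * x) ^ 2 := by rw [h0]
      rw [mul_pow, mul_pow, hss, hχ2] at this
      linarith
    refine ⟨hsq, ?_⟩
    by_cases hz : z = 0
    · exact Or.inl hz
    · right
      have e2 : s 2 = χ := by simpa [hz] using h2
      have e1 : s 1 = χ * (y / x) := by field_simp; linarith
      have e0 : s 0 = χ * (y / x) := by
        field_simp
        have : s 0 * y * y = χ * x * y := by rw [h0]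
        have hxx : s 0 * x * x = χ * y * x := by linear_combination this - s 0 * hsq
        exact mul_right_cancel₀ hx hxx
      have hyx : (y / x) ^ 2 = 1 := by rw [div_pow, hsq, div_self (pow_ne_zero 2 hx)]
      -- The three signs are `χ` or `χ` times `y / x = ±1`, so the determinant of this transposition
      -- is `-χ`.
      have e : χ = -1 := by
        rw [e0, e1, e2] at hdet'
        linear_combination -hdet' - χ * (y / x) ^ 2 * hχ2 - χ * hyx
      rw [hQe, e0, e1, e2, e]
      simp
  · right; right; right; left
    have hsq : z ^ 2 = x ^ 2 := by
      have : (s 0 * z) ^ 2 = (χ * x) ^ 2 := by rw [h0]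
      rw [mul_pow, mul_pow, hss, hχ2] at this
      linarith
    refine ⟨hsq, ?_⟩
    by_cases hy : y = 0
    · exact Or.inl hy
    · right
      have e1 : s 1 = χ := by simpa [hy] using h1'
      have e2 : s 2 = χ * (z / x) := by field_simp; linarith
      have e0 : s 0 = χ * (z / x) := by
        field_simp
        have : s 0 * z * z = χ * x * z := by rw [h0]
        have hxx : s 0 * x * x = χ * z * x := by linear_combination this - s 0 * hsq
        exact mul_right_cancel₀ hx hxx
      have hyx : (z / x) ^ 2 = 1 := by rw [div_pow, hsq, div_self (pow_ne_zero 2 hx)]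
      have e : χ = -1 := by
        rw [e0, e1, e2] at hdet'
        linear_combination -hdet' - χ * (z / x) ^ 2 * hχ2 - χ * hyx
      rw [hQe, e0, e1, e2, e]
      simp
  -- For a 3-cycle, comparing squares of coordinates makes all three equal.
  all_goals
    right; right; right; right
    have a0 := congrArg (· ^ 2) h0
    have a2 := congrArg (· ^ 2) h2
    have a1 := congrArg (· ^ 2) h1'
    simp only [mul_pow, hss, hχ2, one_mul] at a0 a1 a2
    constructor <;> linarith

/-- The line that is orthogonal to a preserved line in a coordinate plane is preserved as well. -/
lemma preserves_orthogonal {Q : Mat3} (hP : IsSignedPerm Q) {x y χ : ℝ} (hx : x ≠ 0)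
    (hxy : y ^ 2 = x ^ 2) (hχ : χ = 1 ∨ χ = -1) :
    (Q *ᵥ ![x, y, 0] = χ • ![x, y, 0] → ∃ χ : ℝ, (χ = 1 ∨ χ = -1) ∧
      Q *ᵥ ![x, -y, 0] = χ • ![x, -y, 0]) ∧
    (Q *ᵥ ![x, 0, y] = χ • ![x, 0, y] → ∃ χ : ℝ, (χ = 1 ∨ χ = -1) ∧
      Q *ᵥ ![x, 0, -y] = χ • ![x, 0, -y]) := by
  obtain ⟨f, hf, s, hs, hQ⟩ := hP
  have hy : y ≠ 0 := fun h => hx (by rw [h] at hxy; simpa using hxy.symm)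
  have hχ0 : χ ≠ 0 := by rcases hχ with rfl | rfl <;> norm_num
  have hs0 : ∀ i, s i ≠ 0 := fun i => by rcases hs i with h | h <;> rw [h] <;> norm_num
  constructor <;> intro h <;>
  · have h0 := congrFun h 0
    have h1 := congrFun h 1
    have h2 := congrFun h 2
    rw [IsSignedPerm.mulVec_apply hQ] at h0 h1 h2
    rcases injective_fin_three_cases hf with ⟨f0, f1, f2⟩ | ⟨f0, f1, f2⟩ | ⟨f0, f1, f2⟩ |
        ⟨f0, f1, f2⟩ | ⟨f0, f1, f2⟩ | ⟨f0, f1, f2⟩ <;>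
      simp [f0, f1, f2, hx, hy, hχ0, hs0] at h0 h1 h2
    all_goals first
      | refine ⟨χ, hχ, ?_⟩
        ext i
        rw [IsSignedPerm.mulVec_apply hQ]
        fin_cases i <;> simp [f0, f1, f2, h0, h1, h2]
        done
      | refine ⟨-χ, by rcases hχ with rfl | rfl <;> simp, ?_⟩
        ext i
        rw [IsSignedPerm.mulVec_apply hQ]
        fin_cases i <;> simp [f0, f1, f2] <;> linarith

/-- Unless `A` is a diagonal of the cube or of a face through the first axis, at most one usable
rotation preserves its line. Nondegeneracy forbids `m ⬝ᵥ A = 0`; for a face diagonal the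
perpendicular diagonal of that face is preserved too, and nonorthogonality of `m` to both amounts to
`u² ≠ v²`. -/
lemma cubicStar_two {u v x y z : ℝ} (hx : x ≠ 0) (hyz : y ≠ z) {Q : Fin 2 → Mat3}
    (h : CubicStar ![u, v, -v] ![x, y, z] 2 Q) :
    (y ^ 2 = x ^ 2 ∧ z ^ 2 = x ^ 2 ∧ u * x + v * y - v * z ≠ 0) ∨
    ((z = 0 ∧ y ^ 2 = x ^ 2 ∨ y = 0 ∧ z ^ 2 = x ^ 2) ∧ u ^ 2 ≠ v ^ 2) := by
  have hA : (![x, y, z] : Vec3) ≠ 0 := fun h => hx (by simpa using congrFun h 0)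
  have hmA := h.dotProduct_ne_zero hA h.t2
  have hmA' : u * x + v * y - v * z ≠ 0 := by
    intro h'
    apply hmA
    simp [dotProduct, Fin.sum_univ_three]
    linarith
  have hpar : ∀ i, Q i *ᵥ ![u, v, -v] ≠ ![u, v, -v] ∧ Q i *ᵥ ![u, v, -v] ≠ -![u, v, -v] := by
    intro i
    have hi := h.t3_pair i (1 - i) (by fin_cases i <;> decide)
    constructor <;> intro h' <;> apply hi <;> rw [h']
    · rw [dotProduct_comm, dot_self_cross]
    · rw [map_neg, LinearMap.neg_apply, neg_dotProduct, dotProduct_comm, dot_self_cross, neg_zero]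
  choose χ hχ h2 using h.t2
  have hcases := fun i =>
    cubic_rotation_cases (h.signedPerm i) (h.det i) (h.ne_one i) hx hyz (hχ i) (h2 i) (hpar i)
  have hne : Q 0 ≠ Q 1 := h.distinct.ne (by decide)
  have hor : (y ^ 2 = x ^ 2 ∧ z ^ 2 = x ^ 2) ∨ z = 0 ∧ y ^ 2 = x ^ 2 ∨ y = 0 ∧ z ^ 2 = x ^ 2 := by
    have hx0 : (0 : ℝ) ^ 2 ≠ x ^ 2 := by
      rw [zero_pow two_ne_zero]
      exact (pow_ne_zero 2 hx).symm
    -- Each generic alternative pins down one matrix, so two distinct rotations must fall under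
    -- different alternatives, or under one that already gives a diagonal.
    rcases hcases 0 with ⟨a1, a2⟩ | ⟨a1, a2⟩ | ⟨a1, a2 | a2⟩ | ⟨a1, a2 | a2⟩ | a1 <;>
      rcases hcases 1 with ⟨b1, b2⟩ | ⟨b1, b2⟩ | ⟨b1, b2 | b2⟩ | ⟨b1, b2 | b2⟩ | b1 <;>
      first
        | exact absurd (a2.trans b2.symm) hne
        | exact absurd (a1.trans b1.symm) hyz
        | exact absurd (b1.trans a1.symm) hyz
        | tauto
        | (rw [a1] at b1; exact absurd b1 hx0)
        | (rw [b1] at a1; exact absurd a1 hx0)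
  rcases hor with h' | h'
  · exact Or.inl ⟨h'.1, h'.2, hmA'⟩
  · refine Or.inr ⟨h', fun huv => ?_⟩
    have huv' := sq_eq_sq_iff_eq_or_eq_neg.mp huv
    rcases h' with ⟨rfl, hxy⟩ | ⟨rfl, hxy⟩
    · have hN : (![x, -y, 0] : Vec3) ≠ 0 := fun h => hx (by simpa using congrFun h 0)
      have := h.dotProduct_ne_zero hN fun i =>
        (preserves_orthogonal (h.signedPerm i) hx hxy (hχ i)).1 (h2 i)
      simp [dotProduct, Fin.sum_univ_three] at this
      apply mul_ne_zero hmA' this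
      linear_combination x ^ 2 * huv - v ^ 2 * hxy
    · have hN : (![x, 0, -z] : Vec3) ≠ 0 := fun h => hx (by simpa using congrFun h 0)
      have := h.dotProduct_ne_zero hN fun i =>
        (preserves_orthogonal (h.signedPerm i) hx hxy (hχ i)).2 (h2 i)
      simp [dotProduct, Fin.sum_univ_three] at this
      apply mul_ne_zero hmA' this
      linear_combination x ^ 2 * huv - v ^ 2 * hxy

/-- The images of `(u, v, -v)` under the rotations that preserve a diagonal of the cube. -/
lemma mulVec_of_diagonal {Q : Mat3} (hP : IsSignedPerm Q) {u v κ x χ : ℝ} (hx : x ≠ 0)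
    (hκ : κ = 1 ∨ κ = -1)
    (h : Q *ᵥ ![x, κ * x, -(κ * x)] = χ • ![x, κ * x, -(κ * x)]) :
    Q *ᵥ ![u, v, -v] = χ • ![u, v, -v] ∨ Q *ᵥ ![u, v, -v] = χ • ![κ * v, κ * u, -v] ∨
      Q *ᵥ ![u, v, -v] = χ • ![κ * v, v, -(κ * u)] := by
  obtain ⟨f, hf, s, hs, hQ⟩ := hP
  have h0 := congrFun h 0
  have h1 := congrFun h 1
  have h2 := congrFun h 2
  rw [IsSignedPerm.mulVec_apply hQ] at h0 h1 h2
  have hκ2 : κ * κ = 1 := by rcases hκ with rfl | rfl <;> norm_num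
  have hm := IsSignedPerm.mulVec_apply hQ ![u, v, -v]
  have hcancel : ∀ a b : ℝ, a * x = b * x → a = b := fun a b h => mul_right_cancel₀ hx h
  rcases injective_fin_three_cases hf with ⟨f0, f1, f2⟩ | ⟨f0, f1, f2⟩ | ⟨f0, f1, f2⟩ |
      ⟨f0, f1, f2⟩ | ⟨f0, f1, f2⟩ | ⟨f0, f1, f2⟩ <;>
    rw [f0] at h0 <;> rw [f1] at h1 <;> rw [f2] at h2 <;>
    simp only [cons_val, Pi.smul_apply, smul_eq_mul] at h0 h1 h2
  · left
    have e0 : s 0 = χ := hcancel _ _ (by linear_combination h0)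
    have e1 : s 1 = χ := hcancel _ _ (by linear_combination κ * h1 + (χ - s 1) * x * hκ2)
    have e2 : s 2 = χ := hcancel _ _ (by linear_combination -κ * h2 + (χ - s 2) * x * hκ2)
    ext i
    rw [hm]
    fin_cases i <;> simp [f0, f1, f2, e0, e1, e2]
  · left
    have e0 : s 0 = χ := hcancel _ _ (by linear_combination h0)
    have e1 : s 1 = -χ := hcancel _ _ (by linear_combination -κ * h1 - (χ + s 1) * x * hκ2)
    have e2 : s 2 = -χ := hcancel _ _ (by linear_combination κ * h2 - (χ + s 2) * x * hκ2)
    ext i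
    rw [hm]
    fin_cases i <;> simp [f0, f1, f2, e0, e1, e2]
  · right; left
    have e0 : s 0 = χ * κ := hcancel _ _ (by linear_combination κ * h0 - s 0 * x * hκ2)
    have e1 : s 1 = χ * κ := hcancel _ _ (by linear_combination h1)
    have e2 : s 2 = χ := hcancel _ _ (by linear_combination -κ * h2 + (χ - s 2) * x * hκ2)
    ext i
    rw [hm]
    fin_cases i <;> simp [f0, f1, f2, e0, e1, e2] <;> ring
  · right; right
    have e0 : s 0 = -(χ * κ) := hcancel _ _ (by linear_combination -κ * h0 - s 0 * x * hκ2)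
    have e1 : s 1 = χ := hcancel _ _ (by linear_combination κ * h1 + (χ - s 1) * x * hκ2)
    have e2 : s 2 = -(χ * κ) := hcancel _ _ (by linear_combination h2)
    ext i
    rw [hm]
    fin_cases i <;> simp [f0, f1, f2, e0, e1, e2] <;> ring
  · right; right
    have e0 : s 0 = χ * κ := hcancel _ _ (by linear_combination κ * h0 - s 0 * x * hκ2)
    have e1 : s 1 = -χ := hcancel _ _ (by linear_combination -κ * h1 - (χ + s 1) * x * hκ2)
    have e2 : s 2 = -(χ * κ) := hcancel _ _ (by linear_combination h2)
    ext i
    rw [hm]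
    fin_cases i <;> simp [f0, f1, f2, e0, e1, e2] <;> ring
  · right; left
    have e0 : s 0 = -(χ * κ) := hcancel _ _ (by linear_combination -κ * h0 - s 0 * x * hκ2)
    have e1 : s 1 = χ * κ := hcancel _ _ (by linear_combination h1)
    have e2 : s 2 = -χ := hcancel _ _ (by linear_combination κ * h2 - (χ + s 2) * x * hκ2)
    ext i
    rw [hm]
    fin_cases i <;> simp [f0, f1, f2, e0, e1, e2] <;> ring

/-- Around a cube diagonal the images of `m` lie on the line of `m` itself, which is useless, or on
two others; by pigeonhole two of three rotations give parallel images. Only face diagonals remain.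
-/
lemma cubicStar_three {u v x y z : ℝ} (hx : x ≠ 0) (hyz : y ≠ z) {Q : Fin 3 → Mat3}
    (h : CubicStar ![u, v, -v] ![x, y, z] 3 Q) :
    (z = 0 ∧ y ^ 2 = x ^ 2 ∨ y = 0 ∧ z ^ 2 = x ^ 2) ∧ u ^ 2 ≠ v ^ 2 := by
  refine (cubicStar_two hx hyz h.restrict).resolve_left ?_
  rintro ⟨hxy, hxz, -⟩
  have hzy : z = -y := by
    rcases sq_eq_sq_iff_eq_or_eq_neg.mp (hxz.trans hxy.symm) with h | h
    · exact absurd h.symm hyz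
    · exact h
  obtain ⟨κ, hκ, rfl⟩ : ∃ κ : ℝ, (κ = 1 ∨ κ = -1) ∧ y = κ * x := by
    rcases sq_eq_sq_iff_eq_or_eq_neg.mp hxy with h | h
    · exact ⟨1, by simp, by rw [h, one_mul]⟩
    · exact ⟨-1, by simp, by rw [h, neg_one_mul]⟩
  subst hzy
  have hcases : ∀ i, ∃ χ : ℝ, Q i *ᵥ ![u, v, -v] = χ • ![κ * v, κ * u, -v] ∨
      Q i *ᵥ ![u, v, -v] = χ • ![κ * v, v, -(κ * u)] := by
    intro i
    obtain ⟨χ, -, h2⟩ := h.t2 i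
    refine ⟨χ, (mulVec_of_diagonal (h.signedPerm i) hx hκ h2).resolve_left fun h' => ?_⟩
    apply h.t3_pair i (i + 1) (by fin_cases i <;> decide)
    rw [h', map_smul, LinearMap.smul_apply, smul_dotProduct, dotProduct_comm, dot_self_cross,
      smul_zero]
  have hpar : ∀ i j, i ≠ j → ∀ (n : Vec3) (χ χ' : ℝ), Q i *ᵥ ![u, v, -v] = χ • n →
      Q j *ᵥ ![u, v, -v] = χ' • n → False := by
    intro i j hij n χ χ' h1 h2
    apply h.t3_pair i j hij
    rw [h1, h2, map_smul, map_smul, LinearMap.smul_apply, cross_self, smul_zero, smul_zero,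
      zero_dotProduct]
  obtain ⟨χ0, h0 | h0⟩ := hcases 0 <;> obtain ⟨χ1, h1 | h1⟩ := hcases 1 <;>
    obtain ⟨χ2, h2 | h2⟩ := hcases 2 <;>
    first
      | exact hpar 0 1 (by decide) _ _ _ h0 h1
      | exact hpar 0 2 (by decide) _ _ _ h0 h2
      | exact hpar 1 2 (by decide) _ _ _ h1 h2

/-- If `m` is a coordinate axis, the image of `m` is a coordinate axis. -/
lemma mulVec_coordinate_axis {Q : Mat3} (hP : IsSignedPerm Q) {x : Vec3} {χ : ℝ}
    (hχ : χ = 1 ∨ χ = -1) (h : Q *ᵥ x = χ • x) :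
    ∃ i, x i ^ 2 = x 0 ^ 2 ∧ ∃ s : ℝ, Q *ᵥ ![1, 0, 0] = s • Pi.single i 1 := by
  obtain ⟨f, hf, s, hs, hQ⟩ := hP
  obtain ⟨i, hi⟩ := Finite.injective_iff_surjective.mp hf 0
  refine ⟨i, ?_, s i, ?_⟩
  · have := congrFun h i
    rw [IsSignedPerm.mulVec_apply hQ, hi, Pi.smul_apply, smul_eq_mul] at this
    rcases hs i with h' | h' <;> rcases hχ with rfl | rfl <;> rw [h'] at this
    · rw [one_mul, one_mul] at this
      rw [this]
    · linear_combination (-x 0 + x i) * this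
    · linear_combination (x 0 - x i) * this
    · linear_combination (x 0 + x i) * this
  · ext j
    rw [IsSignedPerm.mulVec_apply hQ]
    by_cases hj : j = i
    · rw [hj, hi]
      simp
    · have hfj : f j ≠ 0 := fun h => hj (hf (h.trans hi.symm))
      rw [Pi.smul_apply, Pi.single_eq_of_ne hj, smul_zero]
      have : (![1, 0, 0] : Vec3) (f j) = 0 := by
        generalize f j = k at hfj
        fin_cases k
        exacts [absurd rfl hfj, rfl, rfl]
      rw [this, mul_zero]

/-- Images of the first axis are coordinate axes, and independence makes them distinct and different
from the first. Having `2 ≤ n` provides a second index, so that `t3_pair` applies to each `i`. -/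
lemma cubicStar_coordinate_axis {A : Vec3} {n : ℕ} {Q : Fin n → Mat3}
    (h : CubicStar ![1, 0, 0] A n Q) (hn : 2 ≤ n) :
    ∃ p : Fin n → Fin 3, Function.Injective p ∧ ∀ i, p i ≠ 0 ∧ A (p i) ^ 2 = A 0 ^ 2 := by
  choose χ hχ h2 using h.t2
  choose p hp s hs using fun i => mulVec_coordinate_axis (h.signedPerm i) (hχ i) (h2 i)
  have hpar : ∀ i j, i ≠ j → p i ≠ p j ∧ p i ≠ 0 := by
    intro i j hij
    have h3 := h.t3_pair i j hij
    constructor <;> intro hpij <;> apply h3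
    · rw [hs, hs, hpij, map_smul, map_smul, LinearMap.smul_apply, cross_self, smul_zero, smul_zero,
        zero_dotProduct]
    · have : (![1, 0, 0] : Vec3) = Pi.single 0 1 := by
        ext k
        fin_cases k <;> rfl
      rw [hs, hpij, map_smul, LinearMap.smul_apply, smul_dotProduct, this, dotProduct_comm,
        dot_self_cross, smul_zero]
  refine ⟨p, fun i j hij => by_contra fun h' => (hpar i j h').1 hij, fun i => ⟨?_, hp i⟩⟩
  obtain ⟨j, hj⟩ : ∃ j : Fin n, i ≠ j := by
    have : Nontrivial (Fin n) := Fin.nontrivial_iff_two_le.mpr hn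
    obtain ⟨j, hj⟩ := exists_ne i
    exact ⟨j, hj.symm⟩
  exact (hpar i j hj).2

lemma cubicStar_axis_two {A : Vec3} {Q : Fin 2 → Mat3} (h : CubicStar ![1, 0, 0] A 2 Q) :
    A 1 ^ 2 = A 0 ^ 2 ∧ A 2 ^ 2 = A 0 ^ 2 := by
  obtain ⟨p, hp, h'⟩ := cubicStar_coordinate_axis h le_rfl
  have h01 : p 0 ≠ p 1 := hp.ne (by decide)
  obtain ⟨h0, h0'⟩ := h' 0
  obtain ⟨h1, h1'⟩ := h' 1
  generalize p 0 = x at *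
  generalize p 1 = y at *
  fin_cases x <;> fin_cases y <;> simp_all

lemma not_cubicStar_axis_three {A : Vec3} {Q : Fin 3 → Mat3} :
    ¬ CubicStar ![1, 0, 0] A 3 Q := by
  intro h
  obtain ⟨p, hp, h'⟩ := cubicStar_coordinate_axis h (by norm_num)
  obtain ⟨i, hi⟩ := Finite.injective_iff_surjective.mp hp 0
  exact (h' i).1 hi

/-! ### Explicit rotations for cube and face diagonals. -/

lemma isSignedPerm_of_rows {Q : Mat3} (f : Fin 3 → Fin 3) (s : Fin 3 → ℝ)
    (hf : Function.Injective f) (hs : ∀ i, s i = 1 ∨ s i = -1)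
    (hQ : Q = of fun i j => if f i = j then s i else 0) : IsSignedPerm Q :=
  ⟨f, hf, s, hs, fun i j => by rw [hQ, of_apply]⟩

/-- The witnesses are the threefold rotation about the diagonal and its inverse. Up to signs the
volume is the circulant determinant of `(u, κ v, κ v)`, equal to `(u - κ v)² (u + 2 κ v)`. -/
lemma exists_cubicStar_diagonal {u v x κ : ℝ} (hκ : κ = 1 ∨ κ = -1) (h1 : u ≠ κ * v)
    (h2 : u + 2 * κ * v ≠ 0) :
    ∃ Q, CubicStar ![u, v, -v] ![x, κ * x, -(κ * x)] 2 Q := by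
  have hκ2 : κ * κ = 1 := by rcases hκ with rfl | rfl <;> norm_num
  have hne : (u - κ * v) ^ 2 * (u + 2 * κ * v) ≠ 0 :=
    mul_ne_zero (pow_ne_zero 2 (sub_ne_zero.mpr h1)) h2
  have hP : IsSignedPerm !![0, κ, 0; 0, 0, -1; -κ, 0, 0] := by
    refine isSignedPerm_of_rows ![1, 2, 0] ![κ, -1, -κ] (by decide) ?_ ?_
    · intro i
      rcases hκ with rfl | rfl <;> fin_cases i <;> simp
    · ext i j
      fin_cases i <;> fin_cases j <;> simp
  have hT : (!![0, κ, 0; 0, 0, -1; -κ, 0, 0] : Mat3)ᵀ = !![0, 0, -κ; κ, 0, 0; 0, -1, 0] := by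
    ext i j
    fin_cases i <;> fin_cases j <;> rfl
  have hP' : IsSignedPerm !![0, 0, -κ; κ, 0, 0; 0, -1, 0] := hT ▸ hP.transpose
  have hQ : (!![0, κ, 0; 0, 0, -1; -κ, 0, 0] : Mat3) ≠ !![0, 0, -κ; κ, 0, 0; 0, -1, 0] := by
    intro h
    have := congrFun (congrFun h 1) 2
    simp at this
  refine ⟨![!![0, κ, 0; 0, 0, -1; -κ, 0, 0], !![0, 0, -κ; κ, 0, 0; 0, -1, 0]], ?_, ?_, ?_, ?_, ?_,
    ?_, ?_⟩
  · intro i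
    fin_cases i <;> simp [det_fin_three, hκ2]
  · intro i
    fin_cases i
    exacts [hP, hP']
  · intro i h
    have := congrFun (congrFun h 1) 1
    fin_cases i <;> simp at this
  · intro i j h
    fin_cases i <;> fin_cases j <;> first | rfl | exact absurd h hQ | exact absurd h.symm hQ
  · refine fun i => ⟨1, Or.inl rfl, ?_⟩
    ext k
    fin_cases i <;> fin_cases k <;> simp [mulVec, dotProduct, Fin.sum_univ_three, ← mul_assoc, hκ2]
  · intro i j hij h
    fin_cases i <;> fin_cases j <;> first | exact absurd rfl hij | skip
    all_goals
      simp [dotProduct, Fin.sum_univ_three, cross_apply] at h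
      apply hne
      rcases hκ with rfl | rfl <;> ring_nf at h ⊢ <;> linarith
  · intro i j k h1 h2 h3
    omega

/-- The witnesses are the half-turns about the third axis and about the two diagonals of the face;
every triple product equals `±2 v (u² - v²)`. -/
lemma exists_cubicStar_face {u v x κ : ℝ} (hκ : κ = 1 ∨ κ = -1) (hv : v ≠ 0) (h : u ^ 2 ≠ v ^ 2) :
    ∃ Q, CubicStar ![u, v, -v] ![x, κ * x, 0] 3 Q := by
  have hne : 2 * v * (u ^ 2 - v ^ 2) ≠ 0 :=
    mul_ne_zero (mul_ne_zero two_ne_zero hv) (sub_ne_zero.mpr h)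
  have key : ∀ Q : Fin 3 → Mat3, Q 0 = !![-1, 0, 0; 0, -1, 0; 0, 0, 1] →
      Q 1 = !![0, 1, 0; 1, 0, 0; 0, 0, -1] → Q 2 = !![0, -1, 0; -1, 0, 0; 0, 0, -1] →
      CubicStar ![u, v, -v] ![x, κ * x, 0] 3 Q := by
    intro Q q0 q1 q2
    have m0 : Q 0 *ᵥ ![u, v, -v] = ![-u, -v, -v] := by
      rw [q0]; ext i; fin_cases i <;> simp [mulVec, dotProduct, Fin.sum_univ_three]
    have m1 : Q 1 *ᵥ ![u, v, -v] = ![v, u, v] := by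
      rw [q1]; ext i; fin_cases i <;> simp [mulVec, dotProduct, Fin.sum_univ_three]
    have m2 : Q 2 *ᵥ ![u, v, -v] = ![-v, -u, v] := by
      rw [q2]; ext i; fin_cases i <;> simp [mulVec, dotProduct, Fin.sum_univ_three]
    have n01 : Q 0 ≠ Q 1 := fun h => by
      have := congrFun (congrFun h 0) 0
      simp [q0, q1] at this
    have n02 : Q 0 ≠ Q 2 := fun h => by
      have := congrFun (congrFun h 0) 0
      simp [q0, q2] at this
    have n12 : Q 1 ≠ Q 2 := fun h => by
      have := congrFun (congrFun h 0) 1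
      simp [q1, q2] at this
      norm_num at this
    have hall : ∀ p : Fin 3 → Prop, p 0 → p 1 → p 2 → ∀ i, p i := by
      intro p h0 h1 h2 i
      fin_cases i
      exacts [h0, h1, h2]
    refine ⟨hall _ ?_ ?_ ?_, hall _ ?_ ?_ ?_, hall _ ?_ ?_ ?_, ?_, hall _ ?_ ?_ ?_, ?_, ?_⟩
    · simp [q0, det_fin_three]
    · simp [q1, det_fin_three]
    · simp [q2, det_fin_three]
    · refine isSignedPerm_of_rows ![0, 1, 2] ![-1, -1, 1] (by decide) (hall _ ?_ ?_ ?_) ?_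
      iterate 3 simp
      rw [q0]
      ext i j
      fin_cases i <;> fin_cases j <;> simp
    · refine isSignedPerm_of_rows ![1, 0, 2] ![1, 1, -1] (by decide) (hall _ ?_ ?_ ?_) ?_
      iterate 3 simp
      rw [q1]
      ext i j
      fin_cases i <;> fin_cases j <;> simp
    · refine isSignedPerm_of_rows ![1, 0, 2] ![-1, -1, -1] (by decide) (hall _ ?_ ?_ ?_) ?_
      iterate 3 simp
      rw [q2]
      ext i j
      fin_cases i <;> fin_cases j <;> simp
    · intro h
      have := congrFun (congrFun h 0) 0
      rw [q0] at this
      norm_num at this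
    · intro h
      have := congrFun (congrFun h 0) 0
      rw [q1] at this
      norm_num at this
    · intro h
      have := congrFun (congrFun h 0) 0
      rw [q2] at this
      norm_num at this
    · intro i j hij
      fin_cases i <;> fin_cases j <;> first
        | rfl
        | exact absurd hij n01
        | exact absurd hij n02
        | exact absurd hij n12
        | exact absurd hij.symm n01
        | exact absurd hij.symm n02
        | exact absurd hij.symm n12
    · refine ⟨-1, Or.inr rfl, ?_⟩
      rw [q0]
      ext k
      fin_cases k <;> simp [mulVec, dotProduct, Fin.sum_univ_three]
    · refine ⟨κ, hκ, ?_⟩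
      rw [q1]
      ext k
      rcases hκ with rfl | rfl <;> fin_cases k <;> simp [mulVec, dotProduct, Fin.sum_univ_three]
    · refine ⟨-κ, by rcases hκ with rfl | rfl <;> simp, ?_⟩
      rw [q2]
      ext k
      rcases hκ with rfl | rfl <;> fin_cases k <;> simp [mulVec, dotProduct, Fin.sum_univ_three]
    · intro i j hij h'
      apply hne
      fin_cases i <;> fin_cases j <;> first | exact absurd rfl hij | skip
      all_goals
        simp [m0, m1, m2, dotProduct, Fin.sum_univ_three, cross_apply] at h'
        first | linear_combination h' | linear_combination -h'
    · intro i j k hij hik hjk h'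
      apply hne
      fin_cases i <;> fin_cases j <;> fin_cases k <;>
        first | exact absurd rfl hij | exact absurd rfl hik | exact absurd rfl hjk | skip
      all_goals
        simp [m0, m1, m2, dotProduct, Fin.sum_univ_three, cross_apply] at h'
        first | linear_combination h' | linear_combination -h'
  exact ⟨![_, _, _], key _ rfl rfl rfl⟩

/-! ### The austenite vectors. -/

lemma one_add_vecMulVec_transpose (x y : Vec3) :
    (1 + vecMulVec x y)ᵀ = 1 + vecMulVec y x := by
  rw [transpose_add, transpose_one, transpose_vecMulVec]

lemma det_one_add_vecMulVec' (x y : Vec3) : (1 + vecMulVec x y : Mat3).det = 1 + x ⬝ᵥ y := by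
  simp [det_fin_three, vecMulVec_apply, dotProduct, Fin.sum_univ_three, one_apply]
  ring

/-- The vector `a` with `Q U = 1 + a ⊗ m` is determined by `U` and `m`. -/
lemma austenite_unique {U Q : Mat3} {a m : Vec3} (hQ : Q ∈ specialOrthogonalGroup (Fin 3) ℝ)
    (hU : Uᵀ = U) (hm : m ⬝ᵥ m = 1) (h : Q * U = 1 + vecMulVec a m) :
    a = (U * U) *ᵥ m + (U.det - 1 - m ⬝ᵥ ((U * U) *ᵥ m)) • m := by
  -- Squaring eliminates the rotation. Applied to `m`, this gives `a` up to a multiple of `m`, and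
  -- the determinant fixes the multiple.
  have h1 : U * U = (1 + vecMulVec m a) * (1 + vecMulVec a m) := by
    rw [← one_add_vecMulVec_transpose, ← h, transpose_mul, Matrix.mul_assoc, ← Matrix.mul_assoc Qᵀ,
      transpose_mul_self_of_rotation hQ, Matrix.one_mul, hU]
  have h2 : U.det = 1 + a ⬝ᵥ m := by
    rw [← det_one_add_vecMulVec', ← h, det_mul, (mem_rotation_iff.mp hQ).2, one_mul]
  have h3 : (U * U) *ᵥ m = m + a + (a ⬝ᵥ m + a ⬝ᵥ a) • m := by
    have h4 : (1 + vecMulVec a m) *ᵥ m = m + a := by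
      rw [add_mulVec, one_mulVec, vecMulVec_mulVec, hm, MulOpposite.op_one, one_smul]
    rw [h1, ← mulVec_mulVec, h4, add_mulVec, one_mulVec, vecMulVec_mulVec, dotProduct_add,
      op_smul_eq_smul]
  rw [h3, h2]
  simp only [dotProduct_add, dotProduct_smul, hm, smul_eq_mul, dotProduct_comm m a]
  module

lemma AusteniteVectors.eq {U V R : Mat3} {m aU aV : Vec3} (h : AusteniteVectors U V R m aU aV)
    (hU : Uᵀ = U) (hV : Vᵀ = V) (hm : m ⬝ᵥ m = 1) :
    aU = (U * U) *ᵥ m + (U.det - 1 - m ⬝ᵥ ((U * U) *ᵥ m)) • m ∧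
      aV = (V * V) *ᵥ m + (V.det - 1 - m ⬝ᵥ ((V * V) *ᵥ m)) • m := by
  obtain ⟨RU, hRU, RV, hRV, h1, h2, -⟩ := h
  exact ⟨austenite_unique hRU hU hm h1, austenite_unique hRV hV hm h2⟩

/-- The two equations say that `Q = (1 + a ⊗ m) U⁻¹` is a rotation. Since `R V = U + b ⊗ m`, the
vector for `V` is then `a + Q b`. -/
lemma exists_austeniteVectors {U V R : Mat3} {a b m : Vec3} (hU : Uᵀ = U) (hdet : 0 < U.det)
    (h1 : (1 + vecMulVec m a) * (1 + vecMulVec a m) = U * U) (h2 : a ⬝ᵥ m = U.det - 1)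
    (hR : R ∈ specialOrthogonalGroup (Fin 3) ℝ) (hRV : R * V - U = vecMulVec b m) :
    ∃ aV, AusteniteVectors U V R m a aV := by
  have hunit : IsUnit U.det := hdet.ne'.isUnit
  have hinv : U⁻¹ * U = 1 := nonsing_inv_mul _ hunit
  have hQU : (1 + vecMulVec a m) * U⁻¹ * U = 1 + vecMulVec a m := by
    rw [Matrix.mul_assoc, hinv, Matrix.mul_one]
  have hQ : (1 + vecMulVec a m) * U⁻¹ ∈ specialOrthogonalGroup (Fin 3) ℝ := by
    rw [mem_rotation_iff]
    constructor
    · apply mul_eq_one_comm.mp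
      rw [transpose_mul, one_add_vecMulVec_transpose, transpose_nonsing_inv, hU]
      calc U⁻¹ * (1 + vecMulVec m a) * ((1 + vecMulVec a m) * U⁻¹)
          = U⁻¹ * ((1 + vecMulVec m a) * (1 + vecMulVec a m)) * U⁻¹ := by
            simp only [Matrix.mul_assoc]
        _ = (U⁻¹ * U) * (U * U⁻¹) := by rw [h1]; simp only [Matrix.mul_assoc]
        _ = 1 := by rw [hinv, mul_nonsing_inv _ hunit, Matrix.one_mul]
    · have h3 := congrArg Matrix.det hQU
      rw [det_mul, det_one_add_vecMulVec', h2] at h3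
      exact mul_right_cancel₀ hdet.ne' (by linarith)
  refine ⟨a + ((1 + vecMulVec a m) * U⁻¹) *ᵥ b, _, hQ, _, mul_mem hQ hR, hQU, ?_, rfl⟩
  have hRV' : R * V = U + vecMulVec b m := by rw [← hRV]; abel
  rw [Matrix.mul_assoc, hRV', Matrix.mul_add, hQU, mul_vecMulVec, add_vecMulVec, add_assoc]

/-- (T1) becomes membership in the cubic group, and only the directions of `m` and of the
combination of `aU`, `aV` matter. -/
lemma starRotations_iff {a b c d : ℝ} (hδ : (a - d) * (c - d) - b ^ 2 ≠ 0) {U V : Mat3}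
    (hUM : U ∈ Set.range (variant a b c d)) (hVM : V ∈ Set.range (variant a b c d))
    (hU : U *ᵥ Pi.single 2 1 = d • Pi.single 2 1) (hV : V *ᵥ Pi.single 1 1 = d • Pi.single 1 1)
    {m m₀ aU aV A : Vec3} {ρ ρ' μ : ℝ} (hρ : ρ ≠ 0) (hρ' : ρ' ≠ 0) (hm : m = ρ • m₀)
    (hA : μ • aU + (1 - μ) • aV = ρ' • A) {n : ℕ} {Q : Fin n → Mat3} :
    StarRotations (Set.range (variant a b c d)) U V m aU aV μ n Q ↔ CubicStar m₀ A n Q := by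
  have t2 : ∀ (P : Mat3) (χ : ℝ), P *ᵥ (ρ' • A) = χ • (ρ' • A) ↔ P *ᵥ A = χ • A := by
    intro P χ
    rw [mulVec_smul, smul_comm χ, (smul_right_injective _ hρ').eq_iff]
  have t3 : ∀ P P' P'' : Mat3, crossProduct (P *ᵥ (ρ • m₀)) (P' *ᵥ (ρ • m₀)) ⬝ᵥ
      (P'' *ᵥ (ρ • m₀)) ≠ 0 ↔ crossProduct (P *ᵥ m₀) (P' *ᵥ m₀) ⬝ᵥ (P'' *ᵥ m₀) ≠ 0 := by
    intro P P' P''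
    simp only [mulVec_smul, map_smul, LinearMap.smul_apply, smul_dotProduct, dotProduct_smul,
      smul_eq_mul, ne_eq, mul_eq_zero, hρ, false_or]
  have t3' : ∀ P P' : Mat3, crossProduct (P *ᵥ (ρ • m₀)) (P' *ᵥ (ρ • m₀)) ⬝ᵥ (ρ • m₀) ≠ 0 ↔
      crossProduct (P *ᵥ m₀) (P' *ᵥ m₀) ⬝ᵥ m₀ ≠ 0 := by
    intro P P'
    simpa only [one_mulVec] using t3 P P' 1
  subst hm
  constructor
  · intro h
    refine ⟨fun i => (mem_rotation_iff.mp (h.rotation i)).2, fun i => ?_, h.ne_one, h.distinct,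
      fun i => ?_, fun i j hij => (t3' _ _).mp (h.t3_pair i j hij),
      fun i j k h1 h2 h3 => (t3 _ _ _).mp (h.t3_triple i j k h1 h2 h3)⟩
    · exact isSignedPerm_of_conj_mem hδ (h.rotation i) hU hV (h.t1 i).1 (h.t1 i).2
    · obtain ⟨χ, hχ, h2⟩ := h.t2 i
      rw [hA, t2] at h2
      exact ⟨χ, hχ, h2⟩
  · intro h
    refine ⟨h.rotation, h.ne_one, h.distinct, fun i => ?_, fun i => ?_,
      fun i j hij => (t3' _ _).mpr (h.t3_pair i j hij),
      fun i j k h1 h2 h3 => (t3 _ _ _).mpr (h.t3_triple i j k h1 h2 h3)⟩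
    · exact ⟨(h.signedPerm i).conj_mem hUM, (h.signedPerm i).conj_mem hVM⟩
    · obtain ⟨χ, hχ, h2⟩ := h.t2 i
      rw [← t2, ← hA] at h2
      exact ⟨χ, hχ, h2⟩

/-! ### The normalized twin and the second cofactor condition. -/

/-- The image of `base α β γ d` under the rotation by `π` about `(0, 1, 1)`. -/
def baseTwin (α β γ d : ℝ) : Mat3 := !![α, 0, -β; 0, d, 0; -β, 0, γ]

lemma baseTwin_transpose (α β γ d : ℝ) : (baseTwin α β γ d)ᵀ = baseTwin α β γ d := by
  ext i j
  fin_cases i <;> fin_cases j <;> rfl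

lemma baseTwin_mulVec (α β γ d : ℝ) (x : Vec3) :
    baseTwin α β γ d *ᵥ x = ![α * x 0 - β * x 2, d * x 1, -β * x 0 + γ * x 2] := by
  ext i
  fin_cases i <;> simp [baseTwin, mulVec, dotProduct, Fin.sum_univ_three]
  ring

lemma det_base (α β γ d : ℝ) : (base α β γ d).det = d * (α * γ - β ^ 2) := by
  simp [base, det_fin_three]
  ring

lemma det_baseTwin (α β γ d : ℝ) : (baseTwin α β γ d).det = d * (α * γ - β ^ 2) := by
  simp [baseTwin, det_fin_three]
  ring

lemma twofold_conj_base {s : ℝ} (hs : s ^ 2 = 1 / 2) (α β γ d : ℝ) :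
    twofold ![0, s, s] * base α β γ d * twofold ![0, s, s] = baseTwin α β γ d := by
  have h : twofold ![0, s, s] = !![-1, 0, 0; 0, 0, 1; 0, 1, 0] := by
    ext i j
    fin_cases i <;> fin_cases j <;> simp [twofold] <;> linarith
  rw [h]
  ext i j
  fin_cases i <;> fin_cases j <;> simp [base, baseTwin, mul_apply, Fin.sum_univ_three]

/-- The twin fixes only the tensor `b ⊗ m`; a bilinear expression depends on nothing else, so the
cofactor condition may be evaluated on `bII`, `mII`. -/
lemma dotProduct_mulVec_of_vecMulVec_eq {b m B M : Vec3} (h : vecMulVec b m = vecMulVec B M)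
    (K : Mat3) : b ⬝ᵥ (K *ᵥ m) = B ⬝ᵥ (K *ᵥ M) := by
  have key : ∀ x y : Vec3, x ⬝ᵥ (K *ᵥ y) = (vecMulVec x y * Kᵀ).trace := by
    intro x y
    rw [vecMulVec_mul, vecMul_transpose, trace_vecMulVec]
  rw [key, key, h]

lemma smul_eq_of_vecMulVec_eq {b m B M : Vec3} (h : vecMulVec b m = vecMulVec B M) :
    (B ⬝ᵥ b) • m = (B ⬝ᵥ B) • M := by
  have h1 := congrArg (fun X : Mat3 => B ᵥ* X) h
  simpa only [vecMul_vecMulVec] using h1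

lemma cof_base_sq_sub_one (α β γ d : ℝ) : cof (base α β γ d * base α β γ d - 1) =
    !![(β ^ 2 + γ ^ 2 - 1) * (d ^ 2 - 1), -(β * (α + γ)) * (d ^ 2 - 1), 0;
      -(β * (α + γ)) * (d ^ 2 - 1), (α ^ 2 + β ^ 2 - 1) * (d ^ 2 - 1), 0;
      0, 0, (α ^ 2 + β ^ 2 - 1) * (β ^ 2 + γ ^ 2 - 1) - (β * (α + γ)) ^ 2] := by
  have h : base α β γ d * base α β γ d - 1 = !![α ^ 2 + β ^ 2 - 1, β * (α + γ), 0;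
      β * (α + γ), β ^ 2 + γ ^ 2 - 1, 0; 0, 0, d ^ 2 - 1] := by
    ext i j
    fin_cases i <;> fin_cases j <;> simp [base] <;> ring
  rw [h, cof, adjugate_fin_three]
  ext i j
  fin_cases i <;> fin_cases j <;> simp
  ring

section core
variable {α β γ d s : ℝ} {R : Mat3} {b m : Vec3}

lemma mII_base (s : ℝ) : mII (base α β γ d) ![0, s, s] =
    ![-(2 * (s ^ 2 * (β ^ 2 + γ ^ 2 + d ^ 2))⁻¹ * s * (β * (α + γ))),
      2 * s * (1 - (s ^ 2 * (β ^ 2 + γ ^ 2 + d ^ 2))⁻¹ * (β ^ 2 + γ ^ 2)),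
      2 * s * (1 - (s ^ 2 * (β ^ 2 + γ ^ 2 + d ^ 2))⁻¹ * d ^ 2)] := by
  have h : (base α β γ d *ᵥ ![0, s, s]) ⬝ᵥ (base α β γ d *ᵥ ![0, s, s]) =
      s ^ 2 * (β ^ 2 + γ ^ 2 + d ^ 2) := by
    rw [base_mulVec]
    simp [dotProduct, Fin.sum_univ_three]
    ring
  rw [mII, h, ← mulVec_mulVec, base_mulVec, base_mulVec]
  ext i
  fin_cases i <;> simp <;> ring

/-- For a type II twin the second cofactor condition says `|U e| = 1`. -/
lemma TwinData.norm_eq {V : Mat3} (tw : TwinData (base α β γ d) V R b m ![0, s, s])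
    (hs : s ^ 2 = 1 / 2) (hβ : β ≠ 0) (hα : 0 < α) (hγ : 0 < γ) (hd : 0 < d)
    (hD : 0 < α * γ - β ^ 2) (hδ : (α - d) * (γ - d) - β ^ 2 ≠ 0)
    (h1 : (1 - d) * ((1 - α) * (1 - γ) - β ^ 2) = 0) : β ^ 2 + γ ^ 2 + d ^ 2 = 2 := by
  have h := dotProduct_mulVec_of_vecMulVec_eq tw.typeII
    (base α β γ d * cof (base α β γ d * base α β γ d - 1))
  rw [tw.cc2, mII_base, cof_base_sq_sub_one, ← mulVec_mulVec, bII, base_mulVec, base_mulVec] at h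
  -- Here `ν = |U e|⁻²`; in both cases the cofactor condition becomes a nonzero factor times `ν -
  -- 1`.
  obtain ⟨ν, hν⟩ : ∃ ν, ν = (s ^ 2 * (β ^ 2 + γ ^ 2 + d ^ 2))⁻¹ := ⟨_, rfl⟩
  rw [← hν] at h
  suffices hν1 : ν = 1 by
    rw [hν1, hs, eq_comm, inv_eq_one] at hν
    linarith
  simp [mulVec, dotProduct, Fin.sum_univ_three] at h
  rcases mul_eq_zero.mp h1 with hd1 | hB
  · have hd1' : d = 1 := by linarith
    subst hd1'
    have h2 : ((α - 1) * (γ - 1) - β ^ 2) * ((α + 1) * (γ + 1) - β ^ 2) * (ν - 1) = 0 := by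
      linear_combination h - 2 * ((α - 1) * (γ - 1) - β ^ 2) * ((α + 1) * (γ + 1) - β ^ 2) *
        (ν - 1) * hs
    have h3 : (α + 1) * (γ + 1) - β ^ 2 ≠ 0 := by nlinarith
    have h4 := (mul_eq_zero.mp h2).resolve_left (mul_ne_zero hδ h3)
    linarith
  · by_cases hd1' : d = 1
    · subst hd1'
      exact absurd (by linarith) hδ
    have hp : α - 1 ≠ 0 := by
      intro hp
      have : β ^ 2 = 0 := by linear_combination -hB + (γ - 1) * hp
      exact hβ (by simpa using this)
    have h2 : (d ^ 2 - 1) * (α + γ) * (α - 1) * (ν - 1) = 0 := by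
      -- The block minus the identity is singular, hence of the form `(α - 1) (1, r) ⊗ (1, r)`; this
      -- parametrization makes the factorization a polynomial identity.
      obtain ⟨r, hr⟩ : ∃ r, β = r * (α - 1) := ⟨β / (α - 1), (div_mul_cancel₀ _ hp).symm⟩
      have hγ' : γ = 1 + r ^ 2 * (α - 1) := by
        apply mul_left_cancel₀ hp
        rw [hr] at hB
        linear_combination hB
      have h3 : 2 * s ^ 2 * ((d ^ 2 - 1) * (α + γ) * (α - 1) * (ν - 1)) = 0 := by
        rw [hr, hγ'] at h
        rw [hγ']
        linear_combination h
      rw [hs] at h3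
      linarith
    have hd2 : d ^ 2 - 1 ≠ 0 := by
      have : d ^ 2 - 1 = (d - 1) * (d + 1) := by ring
      rw [this]
      exact mul_ne_zero (sub_ne_zero.mpr hd1') (by positivity)
    have h4 := (mul_eq_zero.mp h2).resolve_left
      (mul_ne_zero (mul_ne_zero hd2 (by positivity)) hp)
    linarith

lemma TwinData.exists_smul {V : Mat3} (tw : TwinData (base α β γ d) V R b m ![0, s, s])
    (hs : s ^ 2 = 1 / 2) (hβ : β ≠ 0) (hαγ : 0 < α + γ)
    (hN : β ^ 2 + γ ^ 2 + d ^ 2 = 2) :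
    ∃ ρ : ℝ, ρ ≠ 0 ∧ m = ρ • ![β * (α + γ), 1 - d ^ 2, -(1 - d ^ 2)] := by
  have h := smul_eq_of_vecMulVec_eq tw.typeII
  have hB : bII (base α β γ d) ![0, s, s] ⬝ᵥ bII (base α β γ d) ![0, s, s] = 1 := by
    rw [bII, base_mulVec]
    simp [dotProduct, Fin.sum_univ_three]
    linear_combination (β ^ 2 + γ ^ 2 + d ^ 2) * hs + hN / 2
  have hM : mII (base α β γ d) ![0, s, s] =
      (-2 * s) • ![β * (α + γ), 1 - d ^ 2, -(1 - d ^ 2)] := by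
    have hN' : β ^ 2 + γ ^ 2 = 2 - d ^ 2 := by linarith
    rw [mII_base, hN, hs, hN']
    ext i
    fin_cases i <;> simp <;> ring
  rw [hB, one_smul, hM] at h
  set t := bII (base α β γ d) ![0, s, s] ⬝ᵥ b with ht
  have hs0 : s ≠ 0 := by
    intro h
    rw [h] at hs
    norm_num at hs
  have ht0 : t ≠ 0 := by
    intro ht0
    have := congrFun h 0
    rw [ht0] at this
    simp [hs0, hβ] at this
    exact hαγ.ne' this
  refine ⟨t⁻¹ * (-2 * s), mul_ne_zero (inv_ne_zero ht0) (mul_ne_zero (by norm_num) hs0), ?_⟩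
  rw [mul_smul, ← h, smul_smul, inv_mul_cancel₀ ht0, one_smul]

end core

/-- The austenite vectors exist and are unique, so the quantifier over them can be removed once they
are known explicitly. -/
lemma hasStarRotations_iff {M : Set Mat3} {U V R : Mat3} {b m aU aV : Vec3} (hU : Uᵀ = U)
    (hV : Vᵀ = V) (hm : m ⬝ᵥ m = 1) (hdet : 0 < U.det)
    (hR : R ∈ specialOrthogonalGroup (Fin 3) ℝ) (hRV : R * V - U = vecMulVec b m)
    (haU : (U * U) *ᵥ m + (U.det - 1 - m ⬝ᵥ ((U * U) *ᵥ m)) • m = aU)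
    (haV : (V * V) *ᵥ m + (V.det - 1 - m ⬝ᵥ ((V * V) *ᵥ m)) • m = aV)
    (h1 : (1 + vecMulVec m aU) * (1 + vecMulVec aU m) = U * U) (h2 : aU ⬝ᵥ m = U.det - 1)
    {n : ℕ} : HasStarRotations M U V R m n ↔
      ∃ μ ∈ Set.Ioo (0 : ℝ) 1, ∃ Q : Fin n → Mat3, StarRotations M U V m aU aV μ n Q := by
  constructor
  · rintro ⟨aU', aV', h, μ, hμ, Q, hQ⟩
    obtain ⟨hU', hV'⟩ := h.eq hU hV hm
    rw [haU] at hU'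
    rw [haV] at hV'
    subst hU' hV'
    exact ⟨μ, hμ, Q, hQ⟩
  · rintro ⟨μ, hμ, Q, hQ⟩
    obtain ⟨aV', h⟩ := exists_austeniteVectors hU hdet h1 h2 hR hRV
    have hV' := (h.eq hU hV hm).2
    rw [haV] at hV'
    subst hV'
    exact ⟨aU, aV', h, μ, hμ, Q, hQ⟩

lemma one_add_vecMulVec_mul (m a : Vec3) : (1 + vecMulVec m a) * (1 + vecMulVec a m) =
    1 + vecMulVec m a + vecMulVec a m + (a ⬝ᵥ a) • vecMulVec m m := by
  rw [Matrix.mul_add, Matrix.add_mul, Matrix.add_mul, vecMulVec_mul_vecMulVec, Matrix.mul_one,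
    Matrix.mul_one, Matrix.one_mul, vecMulVec_smul]
  abel

lemma base_mulVec_single (α β γ d : ℝ) :
    base α β γ d *ᵥ Pi.single 2 1 = d • Pi.single 2 1 := by
  rw [base_mulVec]
  ext i
  fin_cases i <;> simp

lemma baseTwin_mulVec_single (α β γ d : ℝ) :
    baseTwin α β γ d *ᵥ Pi.single 1 1 = d • Pi.single 1 1 := by
  rw [baseTwin_mulVec]
  ext i
  fin_cases i <;> simp

lemma exists_sign_of_sq_eq {x y : ℝ} (h : x ^ 2 = y ^ 2) :
    ∃ κ : ℝ, (κ = 1 ∨ κ = -1) ∧ x = κ * y := by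
  rcases sq_eq_sq_iff_eq_or_eq_neg.mp h with h | h
  · exact ⟨1, Or.inl rfl, by rw [h, one_mul]⟩
  · exact ⟨-1, Or.inr rfl, by rw [h, neg_one_mul]⟩

/-! ### The case `d ≠ 1`. -/

section generic
variable {a b c d β q l ρ : ℝ} {R : Mat3} {bv m : Vec3}

/-- The direction of `μ a_U + (1 - μ) a_V` if `d ≠ 1`. -/
def dirNeOne (β q d l μ : ℝ) : Vec3 :=
  ![β * d, q * (μ * d - (1 - μ) * l), q * (μ * l - (1 - μ) * d)]

/-- The block has eigenvalues `1` and `l`; with `q = γ - 1`, `hβq` states that `1` is an eigenvalue,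
and `hq` is then `|U e| = 1`. The point of these parameters is that `(β, q)` is the eigenvector of
the block for `l`, so `U² m` is immediate. -/
lemma hasStarRotations_iff_of_ne_one (hδ : (a - d) * (c - d) - b ^ 2 ≠ 0)
    (hUM : base (l - q) β (q + 1) d ∈ Set.range (variant a b c d))
    (hVM : baseTwin (l - q) β (q + 1) d ∈ Set.range (variant a b c d))
    (hd : 0 < d) (hl : 0 < l) (hdl : l ≠ d)
    (hβq : β ^ 2 = (l - q - 1) * q) (hq : (l + 1) * q = 1 - d ^ 2) (hρ : ρ ≠ 0)
    (hm : m = ρ • ![β, q, -q]) (hm1 : m ⬝ᵥ m = 1)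
    (hR : R ∈ specialOrthogonalGroup (Fin 3) ℝ)
    (hRV : R * baseTwin (l - q) β (q + 1) d - base (l - q) β (q + 1) d = vecMulVec bv m) {n : ℕ} :
    HasStarRotations (Set.range (variant a b c d)) (base (l - q) β (q + 1) d)
        (baseTwin (l - q) β (q + 1) d) R m n ↔
      ∃ μ ∈ Set.Ioo (0 : ℝ) 1, ∃ Q : Fin n → Mat3,
        CubicStar ![β, q, -q] (dirNeOne β q d l μ) n Q := by
  have hl1 : l + 1 ≠ 0 := by positivity
  have h1 : ρ ^ 2 * (β ^ 2 + 2 * q ^ 2) = 1 := by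
    rw [hm] at hm1
    simp [dotProduct, Fin.sum_univ_three] at hm1
    linear_combination hm1
  have hK : ρ ^ 2 * q * (l ^ 2 - d ^ 2) = l + 1 := by
    linear_combination (l + 1) * h1 - (l + 1) * ρ ^ 2 * hβq - ρ ^ 2 * q * hq
  have hS : ρ ^ 2 * (β ^ 2 * l ^ 2 + q ^ 2 * l ^ 2 + d ^ 2 * q ^ 2) = l ^ 2 + d ^ 2 - 1 := by
    linear_combination l ^ 2 * h1 - q * hK - hq
  have hT : ρ ^ 2 * (β ^ 2 * d ^ 2 + q ^ 2 * d ^ 2 + q ^ 2 * l ^ 2) = 1 := by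
    apply mul_left_cancel₀ hl1
    linear_combination hK + (l + 1) * ρ ^ 2 * d ^ 2 * hβq + ρ ^ 2 * q * l ^ 2 * hq
  have hdet : (base (l - q) β (q + 1) d).det = d * l := by
    rw [det_base]
    linear_combination -d * hβq
  have hdet' : (baseTwin (l - q) β (q + 1) d).det = d * l := by
    rw [det_baseTwin]
    linear_combination -d * hβq
  have hU2 : (base (l - q) β (q + 1) d * base (l - q) β (q + 1) d) *ᵥ m =
      ρ • ![β * l ^ 2, q * l ^ 2, -(q * d ^ 2)] := by
    rw [← mulVec_mulVec, hm, base_mulVec, base_mulVec]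
    ext i
    fin_cases i <;> simp
    · linear_combination ρ * β * hβq
    · linear_combination ρ * (l + q + 1) * hβq
    · ring
  have hV2 : (baseTwin (l - q) β (q + 1) d * baseTwin (l - q) β (q + 1) d) *ᵥ m =
      ρ • ![β * l ^ 2, q * d ^ 2, -(q * l ^ 2)] := by
    rw [← mulVec_mulVec, hm, baseTwin_mulVec, baseTwin_mulVec]
    ext i
    fin_cases i <;> simp
    · linear_combination ρ * β * hβq
    · ring
    · linear_combination -ρ * (l + q + 1) * hβq
  have hmU : m ⬝ᵥ (ρ • ![β * l ^ 2, q * l ^ 2, -(q * d ^ 2)]) = l ^ 2 + d ^ 2 - 1 := by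
    rw [hm, ← hS]
    simp [dotProduct, Fin.sum_univ_three]
    ring
  have hmV : m ⬝ᵥ (ρ • ![β * l ^ 2, q * d ^ 2, -(q * l ^ 2)]) = l ^ 2 + d ^ 2 - 1 := by
    rw [hm, ← hS]
    simp [dotProduct, Fin.sum_univ_three]
    ring
  rw [hasStarRotations_iff (base_transpose _ _ _ _) (baseTwin_transpose _ _ _ _) hm1
    (by rw [hdet]; positivity) hR hRV (aU := ((l - d) * ρ) • ![β * d, q * d, q * l])
    (aV := ((l - d) * ρ) • ![β * d, -(q * l), -(q * d)])]
  · refine exists_congr fun μ => and_congr_right fun _ => exists_congr fun Q => ?_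
    refine starRotations_iff hδ hUM hVM (base_mulVec_single _ _ _ _) (baseTwin_mulVec_single _ _ _ _)
      hρ (mul_ne_zero (sub_ne_zero.mpr hdl) hρ) hm ?_
    ext i
    fin_cases i <;> simp [dirNeOne] <;> ring
  · rw [hU2, hmU, hdet, hm]
    ext i
    fin_cases i <;> simp <;> ring
  · rw [hV2, hmV, hdet', hm]
    ext i
    fin_cases i <;> simp <;> ring
  · have haa : (((l - d) * ρ) • ![β * d, q * d, q * l] : Vec3) ⬝ᵥ
        (((l - d) * ρ) • ![β * d, q * d, q * l]) = (l - d) ^ 2 := by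
      simp [dotProduct, Fin.sum_univ_three]
      linear_combination (l - d) ^ 2 * hT
    rw [one_add_vecMulVec_mul, haa, hm]
    ext i j
    fin_cases i <;> fin_cases j <;> simp [base, mul_apply, Fin.sum_univ_three, one_apply]
    · linear_combination (l - q - 1) * hK + (ρ ^ 2 * (l ^ 2 - d ^ 2) - 1) * hβq
    · linear_combination β * hK
    · ring
    · linear_combination β * hK
    · linear_combination q * hK - hβq
    · ring
    · ring
    · ring
    · linear_combination -q * hK - hq
  · rw [hdet, hm]
    simp [dotProduct, Fin.sum_univ_three]
    apply mul_left_cancel₀ hl1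
    linear_combination (l * d - 1) * hK + (l + 1) * (l - d) * ρ ^ 2 * d * hβq -
      (l - d) * ρ ^ 2 * q * l * hq

/-- A face diagonal occurs when a coordinate of `dirNeOne` vanishes, the other then being `±q (l -
d)`; a cube diagonal occurs at `μ = 1/2`, where both have half this size. This halving is the factor
`4`. -/
lemma star_iff_of_ne_one (hd : 0 < d) (hl : 0 < l) (hdl : l ≠ d) (hβ : β ≠ 0)
    (hβq : β ^ 2 = (l - q - 1) * q) (hq : (l + 1) * q = 1 - d ^ 2) :
    ((∃ μ ∈ Set.Ioo (0 : ℝ) 1, ∃ Q : Fin 3 → Mat3,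
        CubicStar ![β, q, -q] (dirNeOne β q d l μ) 3 Q) ↔
      β ^ 2 * d ^ 2 = q ^ 2 * (l - d) ^ 2 ∧ β ^ 2 ≠ q ^ 2) ∧
    ((∃ μ ∈ Set.Ioo (0 : ℝ) 1, ∃ Q : Fin 2 → Mat3,
        CubicStar ![β, q, -q] (dirNeOne β q d l μ) 2 Q) ↔
      (4 * β ^ 2 * d ^ 2 = q ^ 2 * (l - d) ^ 2 ∧ d * l ≠ 1) ∨
        (β ^ 2 * d ^ 2 = q ^ 2 * (l - d) ^ 2 ∧ β ^ 2 ≠ q ^ 2)) := by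
  have hq0 : q ≠ 0 := fun h => hβ (by rw [h, mul_zero] at hβq; simpa using hβq)
  have hx : β * d ≠ 0 := mul_ne_zero hβ hd.ne'
  have hld : l + d ≠ 0 := by positivity
  have hl1 : l + 1 ≠ 0 := by positivity
  have hyz : ∀ μ, q * (μ * d - (1 - μ) * l) ≠ q * (μ * l - (1 - μ) * d) := by
    intro μ h
    apply hdl
    have := mul_left_cancel₀ hq0 h
    linarith
  -- The left factor is `m ⬝ᵥ A` for `μ = 1/2`, up to scale; hence the nondegeneracy condition `d l
  -- ≠ 1`.
  have hdet : (l + 1) * (β ^ 2 * d + q ^ 2 * (d - l)) = q * (d * l - 1) * (l + d) := by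
    linear_combination (l + 1) * d * hβq - q * l * hq
  have hface : ∀ μ, (q * (μ * l - (1 - μ) * d) = 0 ∧ (q * (μ * d - (1 - μ) * l)) ^ 2 = (β * d) ^ 2 ∨
      q * (μ * d - (1 - μ) * l) = 0 ∧ (q * (μ * l - (1 - μ) * d)) ^ 2 = (β * d) ^ 2) →
      β ^ 2 * d ^ 2 = q ^ 2 * (l - d) ^ 2 := by
    rintro μ (⟨h1, h2⟩ | ⟨h1, h2⟩)
    · have h3 := (mul_eq_zero.mp h1).resolve_left hq0
      have h4 : μ * d - (1 - μ) * l = d - l := by linarith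
      rw [h4] at h2
      linear_combination -h2
    · have h3 := (mul_eq_zero.mp h1).resolve_left hq0
      have h4 : μ * l - (1 - μ) * d = l - d := by linarith
      rw [h4] at h2
      linear_combination -h2
  have star : β ^ 2 * d ^ 2 = q ^ 2 * (l - d) ^ 2 → β ^ 2 ≠ q ^ 2 →
      ∃ μ ∈ Set.Ioo (0 : ℝ) 1, ∃ Q : Fin 3 → Mat3,
        CubicStar ![β, q, -q] (dirNeOne β q d l μ) 3 Q := by
    intro h1 h2
    obtain ⟨κ, hκ, hκ'⟩ := exists_sign_of_sq_eq (x := q * (d - l)) (y := β * d)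
      (by linear_combination -h1)
    -- The weight at which the third coordinate of `dirNeOne` vanishes.
    refine ⟨d / (l + d), ⟨by positivity, by rw [div_lt_one (by positivity)]; linarith⟩, ?_⟩
    have hA : dirNeOne β q d l (d / (l + d)) = ![β * d, κ * (β * d), 0] := by
      have hμ : d / (l + d) * (l + d) = d := div_mul_cancel₀ _ hld
      have h3 : q * (d / (l + d) * d - (1 - d / (l + d)) * l) = q * (d - l) := by
        linear_combination q * hμ
      have h4 : q * (d / (l + d) * l - (1 - d / (l + d)) * d) = 0 := by
        linear_combination q * hμ
      rw [dirNeOne, ← hκ', h3, h4]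
    rw [hA]
    exact exists_cubicStar_face hκ hq0 h2
  refine ⟨⟨?_, fun h => star h.1 h.2⟩, ⟨?_, ?_⟩⟩
  · rintro ⟨μ, -, Q, hQ⟩
    obtain ⟨h1, h2⟩ := cubicStar_three hx (hyz μ) hQ
    exact ⟨hface μ h1, h2⟩
  · rintro ⟨μ, -, Q, hQ⟩
    rcases cubicStar_two hx (hyz μ) hQ with ⟨h1, h2, h3⟩ | ⟨h1, h2⟩
    · left
      have h4 := (sq_eq_sq_iff_eq_or_eq_neg.mp (h1.trans h2.symm)).resolve_left (hyz μ)
      have h5 : μ = 1 / 2 := by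
        have h6 : q * ((2 * μ - 1) * (l + d)) = 0 := by linear_combination h4
        have h7 := (mul_eq_zero.mp ((mul_eq_zero.mp h6).resolve_left hq0)).resolve_right hld
        linarith
      subst h5
      refine ⟨by linear_combination -4 * h1, fun h => h3 ?_⟩
      rw [h, sub_self, mul_zero, zero_mul] at hdet
      have := (mul_eq_zero.mp hdet).resolve_left hl1
      linear_combination this
    · exact Or.inr ⟨hface μ h1, h2⟩
  · rintro (⟨h1, h2⟩ | ⟨h1, h2⟩)
    · obtain ⟨κ, hκ, hκ'⟩ := exists_sign_of_sq_eq (x := q * (d - l) / 2) (y := β * d)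
        (by linear_combination -h1 / 4)
      have hκ2 : κ * κ = 1 := by rcases hκ with rfl | rfl <;> norm_num
      have hA : dirNeOne β q d l (1 / 2) = ![β * d, κ * (β * d), -(κ * (β * d))] := by
        rw [dirNeOne, ← hκ']
        ext i
        fin_cases i <;> simp <;> ring
      refine ⟨1 / 2, by norm_num, ?_⟩
      rw [hA]
      refine exists_cubicStar_diagonal hκ (fun h => ?_) (fun h => ?_)
      · apply hld
        apply mul_left_cancel₀ hq0
        rw [h] at hκ'
        linear_combination -2 * hκ' - 2 * q * d * hκ2
      · have h3 : q * (d * l - 1) * (l + d) = 0 := by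
          rw [← hdet]
          linear_combination (l + 1) * β * d * h + 2 * (l + 1) * q * hκ'
        have h4 := (mul_eq_zero.mp ((mul_eq_zero.mp h3).resolve_right hld)).resolve_left hq0
        exact h2 (by linarith)
    · obtain ⟨μ, hμ, Q, hQ⟩ := star h1 h2
      exact ⟨μ, hμ, _, hQ.restrict⟩

end generic

/-! ### The case `d = 1`. -/

section one
variable {a b c α β γ ρ : ℝ} {R : Mat3} {bv m : Vec3}

lemma hasStarRotations_iff_of_one (hδ : (a - 1) * (c - 1) - b ^ 2 ≠ 0)
    (hUM : base α β γ 1 ∈ Set.range (variant a b c 1))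
    (hVM : baseTwin α β γ 1 ∈ Set.range (variant a b c 1))
    (hD : 0 < α * γ - β ^ 2) (hβγ : β ^ 2 + γ ^ 2 = 1)
    (hm : m = ρ • ![1, 0, 0]) (hm1 : m ⬝ᵥ m = 1)
    (hR : R ∈ specialOrthogonalGroup (Fin 3) ℝ)
    (hRV : R * baseTwin α β γ 1 - base α β γ 1 = vecMulVec bv m) {n : ℕ} :
    HasStarRotations (Set.range (variant a b c 1)) (base α β γ 1) (baseTwin α β γ 1) R m n ↔
      ∃ μ ∈ Set.Ioo (0 : ℝ) 1, ∃ Q : Fin n → Mat3, CubicStar ![1, 0, 0]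
        ![α * γ - β ^ 2 - 1, μ * (β * (α + γ)), -((1 - μ) * (β * (α + γ)))] n Q := by
  have h1 : ρ ^ 2 = 1 := by
    rw [hm] at hm1
    simp [dotProduct, Fin.sum_univ_three] at hm1
    linear_combination hm1
  have hρ : ρ ≠ 0 := by
    rintro rfl
    norm_num at h1
  have hdet : (base α β γ 1).det = α * γ - β ^ 2 := by rw [det_base, one_mul]
  have hdet' : (baseTwin α β γ 1).det = α * γ - β ^ 2 := by rw [det_baseTwin, one_mul]
  have hU2 : (base α β γ 1 * base α β γ 1) *ᵥ m = ρ • ![α ^ 2 + β ^ 2, β * (α + γ), 0] := by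
    rw [← mulVec_mulVec, hm, base_mulVec, base_mulVec]
    ext i
    fin_cases i <;> simp <;> ring
  have hV2 : (baseTwin α β γ 1 * baseTwin α β γ 1) *ᵥ m =
      ρ • ![α ^ 2 + β ^ 2, 0, -(β * (α + γ))] := by
    rw [← mulVec_mulVec, hm, baseTwin_mulVec, baseTwin_mulVec]
    ext i
    fin_cases i <;> simp <;> ring
  have hmU : m ⬝ᵥ (ρ • ![α ^ 2 + β ^ 2, β * (α + γ), 0]) = α ^ 2 + β ^ 2 := by
    rw [hm]
    simp [dotProduct, Fin.sum_univ_three]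
    linear_combination (α ^ 2 + β ^ 2) * h1
  have hmV : m ⬝ᵥ (ρ • ![α ^ 2 + β ^ 2, 0, -(β * (α + γ))]) = α ^ 2 + β ^ 2 := by
    rw [hm]
    simp [dotProduct, Fin.sum_univ_three]
    linear_combination (α ^ 2 + β ^ 2) * h1
  rw [hasStarRotations_iff (base_transpose _ _ _ _) (baseTwin_transpose _ _ _ _) hm1
    (by rw [hdet]; exact hD) hR hRV (aU := ρ • ![α * γ - β ^ 2 - 1, β * (α + γ), 0])
    (aV := ρ • ![α * γ - β ^ 2 - 1, 0, -(β * (α + γ))])]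
  · refine exists_congr fun μ => and_congr_right fun _ => exists_congr fun Q => ?_
    refine starRotations_iff hδ hUM hVM (base_mulVec_single _ _ _ _) (baseTwin_mulVec_single _ _ _ _)
      hρ hρ hm ?_
    ext i
    fin_cases i <;> simp <;> ring
  · rw [hU2, hmU, hdet, hm]
    ext i
    fin_cases i <;> simp
    ring
  · rw [hV2, hmV, hdet', hm]
    ext i
    fin_cases i <;> simp
    ring
  · rw [one_add_vecMulVec_mul, hm]
    ext i j
    fin_cases i <;> fin_cases j <;>
      simp [base, mul_apply, dotProduct, Fin.sum_univ_three, one_apply]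
    · linear_combination (2 * (α * γ - β ^ 2 - 1) + ((α * γ - β ^ 2 - 1) ^ 2 +
        (β * (α + γ)) ^ 2) * (ρ ^ 2 + 1)) * h1 + (α ^ 2 + β ^ 2) * hβγ
    · linear_combination β * (α + γ) * h1
    · linear_combination β * (α + γ) * h1
    · linear_combination -hβγ
  · rw [hdet, hm]
    simp [dotProduct, Fin.sum_univ_three]
    linear_combination (α * γ - β ^ 2 - 1) * h1

/-- Since `m` is a coordinate axis, two rotations need all coordinates of `A` to agree up to sign.
Equality of the last two gives `μ = 1/2`, and the first gives the equation. -/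
lemma star_iff_of_one (hk : β * (α + γ) ≠ 0) :
    (¬ ∃ μ ∈ Set.Ioo (0 : ℝ) 1, ∃ Q : Fin 3 → Mat3, CubicStar ![1, 0, 0]
        ![α * γ - β ^ 2 - 1, μ * (β * (α + γ)), -((1 - μ) * (β * (α + γ)))] 3 Q) ∧
    ((∃ μ ∈ Set.Ioo (0 : ℝ) 1, ∃ Q : Fin 2 → Mat3, CubicStar ![1, 0, 0]
        ![α * γ - β ^ 2 - 1, μ * (β * (α + γ)), -((1 - μ) * (β * (α + γ)))] 2 Q) ↔
      4 * (α * γ - β ^ 2 - 1) ^ 2 = (β * (α + γ)) ^ 2) := by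
  refine ⟨?_, ?_, fun h => ?_⟩
  · rintro ⟨μ, -, Q, hQ⟩
    exact not_cubicStar_axis_three hQ
  · rintro ⟨μ, -, Q, hQ⟩
    have h := cubicStar_axis_two hQ
    simp only [cons_val] at h
    obtain ⟨h1, h2⟩ := h
    have h3 : (β * (α + γ)) ^ 2 * (2 * μ - 1) = 0 := by linear_combination h1 - h2
    have h4 : μ = 1 / 2 := by
      have := (mul_eq_zero.mp h3).resolve_left (pow_ne_zero 2 hk)
      linarith
    subst h4
    linear_combination -4 * h1
  · obtain ⟨κ, hκ, hκ'⟩ := exists_sign_of_sq_eq (x := β * (α + γ) / 2) (y := α * γ - β ^ 2 - 1)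
      (by linear_combination -h / 4)
    have hA : ![α * γ - β ^ 2 - 1, 1 / 2 * (β * (α + γ)), -((1 - 1 / 2) * (β * (α + γ)))] =
        ![α * γ - β ^ 2 - 1, κ * (α * γ - β ^ 2 - 1), -(κ * (α * γ - β ^ 2 - 1))] := by
      rw [← hκ']
      ext i
      fin_cases i <;> simp <;> ring
    have h0 : (![1, 0, 0] : Vec3) = ![1, 0, -0] := by rw [neg_zero]
    refine ⟨1 / 2, by norm_num, ?_⟩
    rw [hA, h0]
    exact exists_cubicStar_diagonal hκ (by simp) (by simp)

end one

/-! ### Eigenvalues of the variants and reduction to the normalized twin. -/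

lemma charpoly_variant_eval (a b c d : ℝ) (k : Fin 12) (x : ℝ) :
    (variant a b c d k).charpoly.eval x = (x - d) * ((x - a) * (x - c) - b ^ 2) := by
  obtain ⟨σ, β, hβ, -, h⟩ := variant_eq_submatrix a b c d k
  have hβ2 : β ^ 2 = b ^ 2 := by rcases hβ with rfl | rfl <;> ring
  have h1 : variant a b c d k = reindex σ.symm σ.symm (base a β c d) := h
  rw [h1, charpoly_reindex, eval_charpoly, ← hβ2]
  simp [det_fin_three, base]
  ring

lemma OrderedEigenvalues.eval {a b c d : ℝ} {k : Fin 12} {l₁ l₂ l₃ : ℝ}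
    (h : OrderedEigenvalues (variant a b c d k) l₁ l₂ l₃) (x : ℝ) :
    (x - d) * ((x - a) * (x - c) - b ^ 2) = (x - l₁) * (x - l₂) * (x - l₃) := by
  rw [← charpoly_variant_eval a b c d k, h.2.2]
  simp

/-- The middle one of three ordered numbers is determined by the cubic polynomial. -/
lemma middle_root_eq_one {l₁ l₂ l₃ k₁ k₃ : ℝ} (h12 : l₁ ≤ l₂) (h23 : l₂ ≤ l₃) (hk1 : k₁ ≤ 1)
    (hk3 : 1 ≤ k₃)
    (h : ∀ x : ℝ, (x - l₁) * (x - l₂) * (x - l₃) = (x - k₁) * (x - 1) * (x - k₃)) : l₂ = 1 := by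
  have e0 := h 0
  have e1 := h 1
  have e2 := h (-1)
  have hsum : l₁ + l₂ + l₃ = k₁ + 1 + k₃ := by linarith
  have hprod : l₁ * l₂ * l₃ = k₁ * k₃ := by linarith
  by_contra hne
  have h1 : (1 - l₁) * (1 - l₂) * (1 - l₃) = 0 := by rw [h 1]; ring
  rcases mul_eq_zero.mp h1 with h1 | h1
  · have hl1 : l₁ = 1 := by
      rcases mul_eq_zero.mp h1 with h1 | h1
      · linarith
      · exact absurd (by linarith) hne
    subst hl1
    have hl2 : 1 < l₂ := lt_of_le_of_ne h12 (Ne.symm hne)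
    have hk : (k₁ - 1) * (k₁ - l₂) * (k₁ - l₃) = 0 := by rw [h k₁]; ring
    have hk1' : k₁ = 1 := by
      rcases mul_eq_zero.mp hk with hk | hk
      · rcases mul_eq_zero.mp hk with hk | hk <;> linarith
      · linarith
    subst hk1'
    have : (l₂ - 1) * (l₃ - 1) = 0 := by linear_combination hprod - hsum
    rcases mul_eq_zero.mp this with h | h <;> linarith
  · have hl3 : l₃ = 1 := by linarith
    subst hl3
    have hl2 : l₂ < 1 := lt_of_le_of_ne h23 hne
    have hk : (k₃ - l₁) * (k₃ - l₂) * (k₃ - 1) = 0 := by rw [h k₃]; ring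
    have hk3' : k₃ = 1 := by
      rcases mul_eq_zero.mp hk with hk | hk
      · rcases mul_eq_zero.mp hk with hk | hk <;> linarith
      · linarith
    subst hk3'
    have : (l₁ - 1) * (l₂ - 1) = 0 := by linear_combination hprod - hsum
    rcases mul_eq_zero.mp this with h | h <;> linarith

/-- A type II twin of two variants that satisfies the second cofactor condition is conjugate, by a
cubic rotation, to one with axis `(0, 1, 1)`. -/
lemma exists_conj_base {a b c d : ℝ} (hb : b ≠ 0) {i j : Fin 12} {R : Mat3} {bv m : Vec3}
    (htwin : IsTypeIITwin (variant a b c d i) (variant a b c d j) R bv m)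
    (hcc2 : bv ⬝ᵥ ((variant a b c d i * cof (variant a b c d i * variant a b c d i - 1)) *ᵥ m) = 0) :
    (a - d) * (c - d) - b ^ 2 ≠ 0 ∧ ∃ P : Mat3, P ∈ specialOrthogonalGroup (Fin 3) ℝ ∧
      IsSignedPerm P ∧ ∃ α β γ s : ℝ, s ^ 2 = 1 / 2 ∧ (α = a ∧ γ = c ∨ α = c ∧ γ = a) ∧
        (β = b ∨ β = -b) ∧ conj P (variant a b c d i) = base α β γ d ∧
        conj P (variant a b c d j) = baseTwin α β γ d ∧
        TwinData (conj P (variant a b c d i)) (conj P (variant a b c d j)) (conj P R) (P *ᵥ bv)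
          (P *ᵥ m) ![0, s, s] := by
  obtain ⟨e, he, huniq, hbm⟩ := htwin.typeII
  have hδ := simple_of_unique_axis hb he huniq
  obtain ⟨hpq, hep, heq, hoff⟩ := axis_of_unique_axis hb htwin.ne he huniq
  -- The relative sign of the two nonzero coordinates of `e`, absorbed into the cubic rotation.
  obtain ⟨ε, hε, hε'⟩ := exists_sign_of_sq_eq (heq.trans hep.symm)
  have hεε : ε * ε = 1 := by rcases hε with h | h <;> rw [h] <;> norm_num
  obtain ⟨P, hP, hPs, hPx⟩ := exists_cubic_rotation hpq hε
  have hPe : P *ᵥ e = ![0, e (pos i), e (pos i)] := by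
    obtain ⟨h2, h1, k, s, hkp, hkq, h0⟩ := hPx e
    rw [hoff k hkp hkq, mul_zero] at h0
    rw [hε', ← mul_assoc, hεε, one_mul] at h1
    ext n
    fin_cases n
    exacts [h0, h1, h2]
  have hPp : P *ᵥ Pi.single (pos i) 1 = Pi.single 2 1 := by
    obtain ⟨h2, h1, k, s, hkp, hkq, h0⟩ := hPx (Pi.single (pos i) 1)
    rw [Pi.single_eq_same] at h2
    rw [Pi.single_eq_of_ne hpq.symm, mul_zero] at h1
    rw [Pi.single_eq_of_ne hkp, mul_zero] at h0
    ext n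
    fin_cases n
    exacts [h0, h1, h2]
  have tw : TwinData (variant a b c d i) (variant a b c d j) R bv m e :=
    ⟨htwin.rotation, htwin.compatible, htwin.unit, he, hbm, hcc2⟩
  have tw' := tw.conj hP
  rw [hPe] at tw'
  have hmem : conj P (variant a b c d i) ∈ Set.range (variant a b c d) := hPs.conj_mem ⟨i, rfl⟩
  obtain ⟨k, hk⟩ := hmem
  -- `P` moves the distinguished axis to the third one, so the conjugated variant is among the four
  -- with `d` in the last place.
  have hk2 : pos k = 2 := by
    by_contra hne
    have h1 : variant a b c d k *ᵥ Pi.single 2 1 = d • Pi.single 2 1 := by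
      rw [hk, ← hPp, conj_mulVec hP, variant_mulVec_single, mulVec_smul]
    have h2 := eq_zero_of_eigenvector hδ h1 (Ne.symm hne)
    rw [Pi.single_eq_same] at h2
    exact one_ne_zero h2
  have hbase : ∃ α β γ, (α = a ∧ γ = c ∨ α = c ∧ γ = a) ∧ (β = b ∨ β = -b) ∧
      variant a b c d k = base α β γ d := by
    fin_cases k
    · exact ⟨a, b, c, by simp, by simp, rfl⟩
    · exact ⟨a, -b, c, by simp, by simp, rfl⟩
    · exact ⟨c, b, a, by simp, by simp, rfl⟩
    · exact ⟨c, -b, a, by simp, by simp, rfl⟩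
    all_goals exact absurd hk2 (by decide)
  obtain ⟨α, β, γ, hαγ, hβ, hkb⟩ := hbase
  refine ⟨hδ, P, hP, hPs, α, β, γ, e (pos i), hep, hαγ, hβ, hk.symm.trans hkb, ?_, tw'⟩
  rw [tw'.axis.2, ← hk, hkb, twofold_conj_base hep]

/-! ### The conditions in terms of eigenvalues. -/

section core
variable {a b c d α β γ s l₁ l₃ : ℝ} {R : Mat3} {bv m : Vec3}

lemma core_of_ne_one (hb : b ≠ 0) (hd : 0 < d) (hd1 : d ≠ 1)
    (hδ : (a - d) * (c - d) - b ^ 2 ≠ 0) (hs : s ^ 2 = 1 / 2)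
    (hαγ : α = a ∧ γ = c ∨ α = c ∧ γ = a) (hβ : β = b ∨ β = -b) (hα : 0 < α) (hγ : 0 < γ)
    (hD : 0 < a * c - b ^ 2)
    (hUM : base α β γ d ∈ Set.range (variant a b c d))
    (hVM : baseTwin α β γ d ∈ Set.range (variant a b c d))
    (tw : TwinData (base α β γ d) (baseTwin α β γ d) R bv m ![0, s, s])
    (h1 : (1 - a) * (1 - c) - b ^ 2 = 0) :
    (HasStarRotations (Set.range (variant a b c d)) (base α β γ d) (baseTwin α β γ d) R m 3 ↔
      a ≠ c ∧ d ^ 2 * (d ^ 2 + (a + c - 1) ^ 2 - 2) = (d - (a + c - 1)) ^ 2 * (1 - d ^ 2)) ∧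
    ((HasStarRotations (Set.range (variant a b c d)) (base α β γ d) (baseTwin α β γ d) R m 2 ∧
      ¬ HasStarRotations (Set.range (variant a b c d)) (base α β γ d) (baseTwin α β γ d) R m 3) ↔
      4 * d ^ 2 * (d ^ 2 + (a + c - 1) ^ 2 - 2) = (d - (a + c - 1)) ^ 2 * (1 - d ^ 2) ∧
        d * (a + c - 1) ≠ 1) := by
  have hβ2 : β ^ 2 = b ^ 2 := by rcases hβ with rfl | rfl <;> ring
  have hβ0 : β ≠ 0 := by rcases hβ with rfl | rfl <;> simpa
  have hsum : a + c - 1 = α + γ - 1 := by rcases hαγ with ⟨rfl, rfl⟩ | ⟨rfl, rfl⟩ <;> ring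
  have hprod : a * c = α * γ := by rcases hαγ with ⟨rfl, rfl⟩ | ⟨rfl, rfl⟩ <;> ring
  have hne : a ≠ c ↔ α ≠ γ := by
    rcases hαγ with ⟨rfl, rfl⟩ | ⟨rfl, rfl⟩
    exacts [Iff.rfl, ne_comm]
  have hB : (1 - α) * (1 - γ) - β ^ 2 = 0 := by rw [hβ2]; linear_combination h1 + hsum - hprod
  have hN := tw.norm_eq hs hβ0 hα hγ hd (by rw [hβ2, ← hprod]; exact hD)
    (by rw [hβ2]; convert hδ using 1; linear_combination d * hsum - hprod) (by rw [hB, mul_zero])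
  obtain ⟨ρ, hρ, hm⟩ := tw.exists_smul hs hβ0 (by positivity) hN
  obtain ⟨l, hl⟩ : ∃ l, l = α + γ - 1 := ⟨_, rfl⟩
  obtain ⟨q, hq⟩ : ∃ q, q = γ - 1 := ⟨_, rfl⟩
  rw [hsum, ← hl]
  have hα' : α = l - q := by linarith
  have hγ' : γ = q + 1 := by linarith
  have hl0 : 0 < l := by
    have : l = a * c - b ^ 2 := by rw [← hβ2, hprod]; linear_combination hl - hB
    rw [this]
    exact hD
  rw [hne]
  clear hsum hprod hne hl hq hαγ
  subst hα' hγ'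
  have hβq : β ^ 2 = (l - q - 1) * q := by linear_combination -hB
  have hqd : (l + 1) * q = 1 - d ^ 2 := by linear_combination hN - hβq
  have hl1 : l + 1 ≠ 0 := by positivity
  have hq0 : q ≠ 0 := fun h => hβ0 (by rw [h, mul_zero] at hβq; simpa using hβq)
  -- For `l = d` the relation `hqd` gives `q = 1 - l`, and then `β² = -2 (l - 1)²`.
  have hdl : l ≠ d := by
    rintro rfl
    have h2 : (l + 1) * (l - 1 + q) = 0 := by linear_combination hqd
    have h3 := (mul_eq_zero.mp h2).resolve_left hl1
    have h4 : (l + 1) * (l - 1) = -(1 - l ^ 2) := by ring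
    have hqq : q = 1 - l := by linarith
    rw [hqq] at hβq
    nlinarith [mul_pos hl0 hl0, sq_nonneg (l - 1), pow_pos (abs_pos.mpr hβ0) 2, sq_abs β]
  have hm' : m = (ρ * (l + 1)) • ![β, q, -q] := by
    rw [hm, ← hqd]
    ext i
    fin_cases i <;> simp <;> ring
  have hstar := fun n => hasStarRotations_iff_of_ne_one (n := n) hδ hUM hVM hd hl0 hdl hβq hqd
    (mul_ne_zero hρ hl1) hm' tw.unit tw.rotation tw.compatible
  obtain ⟨s3, s2⟩ := star_iff_of_ne_one hd hl0 hdl hβ0 hβq hqd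
  -- Rests on `(l + 1) β² = q (d² + l² - 2)` and `(l + 1) q = 1 - d²`; it is used with `t = 1` for
  -- stars and `t = 4` for half-stars.
  have hcond : ∀ t : ℝ, t * β ^ 2 * d ^ 2 = q ^ 2 * (l - d) ^ 2 ↔
      t * d ^ 2 * (d ^ 2 + l ^ 2 - 2) = (d - l) ^ 2 * (1 - d ^ 2) := by
    intro t
    have h2 : (l + 1) * (t * β ^ 2 * d ^ 2 - q ^ 2 * (l - d) ^ 2) =
        q * (t * d ^ 2 * (d ^ 2 + l ^ 2 - 2) - (d - l) ^ 2 * (1 - d ^ 2)) := by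
      linear_combination (l + 1) * t * d ^ 2 * hβq - (t * d ^ 2 * q + q * (l - d) ^ 2) * hqd
    rw [← sub_eq_zero, ← sub_eq_zero (b := (d - l) ^ 2 * (1 - d ^ 2))]
    constructor <;> intro h
    · rw [h, mul_zero] at h2
      exact (mul_eq_zero.mp h2.symm).resolve_left hq0
    · rw [h, mul_zero] at h2
      exact (mul_eq_zero.mp h2).resolve_left hl1
  have hβne : β ^ 2 ≠ q ^ 2 ↔ l - q ≠ q + 1 := by
    rw [not_iff_not, hβq, sq]
    constructor <;> intro h
    · have := mul_right_cancel₀ hq0 h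
      linarith
    · rw [h]
      ring
  have h3 : HasStarRotations (Set.range (variant a b c d)) (base (l - q) β (q + 1) d)
      (baseTwin (l - q) β (q + 1) d) R m 3 ↔
      l - q ≠ q + 1 ∧ d ^ 2 * (d ^ 2 + l ^ 2 - 2) = (d - l) ^ 2 * (1 - d ^ 2) := by
    have h4 := hcond 1
    rw [one_mul, one_mul] at h4
    rw [hstar, s3, h4, hβne, and_comm]
  refine ⟨h3, ?_⟩
  rw [h3, hstar, s2, hcond]
  have h4 := hcond 1
  rw [one_mul, one_mul] at h4
  rw [h4, hβne]
  constructor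
  · rintro ⟨h | h, h'⟩
    · exact h
    · exact absurd h.symm h'
  · rintro ⟨h, h'⟩
    -- The equations for `t = 1` and `t = 4` cannot hold together because `β d ≠ 0`.
    refine ⟨Or.inl ⟨h, h'⟩, fun h5 => ?_⟩
    have h6 := (hcond 4).mpr h
    have h7 := h4.mpr h5.2
    have h8 : β ^ 2 * d ^ 2 = 0 := by linarith
    have : 0 < β ^ 2 * d ^ 2 := by positivity
    linarith

lemma core_of_one (hb : b ≠ 0)
    (hδ : (a - 1) * (c - 1) - b ^ 2 ≠ 0) (hs : s ^ 2 = 1 / 2)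
    (hαγ : α = a ∧ γ = c ∨ α = c ∧ γ = a) (hβ : β = b ∨ β = -b) (hα : 0 < α) (hγ : 0 < γ)
    (hD : 0 < a * c - b ^ 2)
    (hUM : base α β γ 1 ∈ Set.range (variant a b c 1))
    (hVM : baseTwin α β γ 1 ∈ Set.range (variant a b c 1))
    (tw : TwinData (base α β γ 1) (baseTwin α β γ 1) R bv m ![0, s, s])
    (hsum : a + c = l₁ + l₃) (hprod : a * c - b ^ 2 = l₁ * l₃) :
    (¬ HasStarRotations (Set.range (variant a b c 1)) (base α β γ 1) (baseTwin α β γ 1) R m 3) ∧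
    (HasStarRotations (Set.range (variant a b c 1)) (base α β γ 1) (baseTwin α β γ 1) R m 2 ↔
      l₁ ^ 2 * (5 * l₃ ^ 2 - 1) = 8 * l₁ * l₃ - 5 + l₃ ^ 2) := by
  have hβ2 : β ^ 2 = b ^ 2 := by rcases hβ with rfl | rfl <;> ring
  have hβ0 : β ≠ 0 := by rcases hβ with rfl | rfl <;> simpa
  have hs' : a + c = α + γ := by rcases hαγ with ⟨rfl, rfl⟩ | ⟨rfl, rfl⟩ <;> ring
  have hp' : a * c = α * γ := by rcases hαγ with ⟨rfl, rfl⟩ | ⟨rfl, rfl⟩ <;> ring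
  have hD' : 0 < α * γ - β ^ 2 := by rw [hβ2, ← hp']; exact hD
  have hN := tw.norm_eq hs hβ0 hα hγ one_pos hD'
    (by rw [hβ2]; convert hδ using 1; linear_combination hs' - hp') (by rw [sub_self, zero_mul])
  obtain ⟨ρ, hρ, hm⟩ := tw.exists_smul hs hβ0 (by positivity) hN
  have hk : β * (α + γ) ≠ 0 := mul_ne_zero hβ0 (by positivity)
  have hm' : m = (ρ * (β * (α + γ))) • ![1, 0, 0] := by
    rw [hm]
    ext i
    fin_cases i <;> simp
  have hN' : β ^ 2 + γ ^ 2 = 1 := by linarith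
  have hstar := fun n => hasStarRotations_iff_of_one (n := n) hδ hUM hVM hD' hN' hm' tw.unit
    tw.rotation tw.compatible
  obtain ⟨s3, s2⟩ := star_iff_of_one (α := α) hk
  rw [hstar, hstar, s2]
  refine ⟨s3, ?_⟩
  have hDl : α * γ - β ^ 2 = l₁ * l₃ := by rw [hβ2, ← hp', hprod]
  have hsl : α + γ = l₁ + l₃ := by rw [← hs', hsum]
  -- For the block `W`, the matrix `W² - 1` has a zero diagonal entry by `hN'`, so the square of its
  -- off-diagonal entry is `-det (W² - 1) = -(l₁² - 1) (l₃² - 1)`.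
  have hk2 : (β * (α + γ)) ^ 2 = l₁ ^ 2 + l₃ ^ 2 - 1 - (l₁ * l₃) ^ 2 := by
    have h1 : l₁ ^ 2 + l₃ ^ 2 = α ^ 2 + 2 * β ^ 2 + γ ^ 2 := by
      linear_combination -(l₁ + l₃ + α + γ) * hsl + 2 * hDl
    rw [h1, ← hDl]
    linear_combination (α ^ 2 + β ^ 2 - 1) * hN'
  rw [hDl, hk2]
  constructor <;> intro h <;> linarith

end core

end StarTwin

/-! ### Assembly of the cases. -/

theorem mainTheorem1 (a b c d : ℝ) (ha : 0 < a) (hb : 0 < b) (hc : 0 < c) (hd : 0 < d)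
    (hpos : ∀ i, (StarTwin.variant a b c d i).PosDef)
    (l₁ l₂ l₃ : ℝ) (hl : StarTwin.OrderedEigenvalues (StarTwin.variant a b c d 0) l₁ l₂ l₃)
    (i j : Fin 12) (hij : i ≠ j) (R : StarTwin.Mat3) (bv m : StarTwin.Vec3)
    (htwin : StarTwin.IsTypeIITwin (StarTwin.variant a b c d i) (StarTwin.variant a b c d j) R bv m)
    (hcof : StarTwin.CofactorConditions (StarTwin.variant a b c d i) bv m) :
    (0 < l₁ ∧ l₁ ≤ 1 ∧ l₂ = 1 ∧ 1 ≤ l₃) ∧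
    (StarTwin.IsTypeIIHalfStarTwin (Set.range (StarTwin.variant a b c d))
        (StarTwin.variant a b c d i) (StarTwin.variant a b c d j) R bv m ↔
      (d ≠ 1 ∧ l₁ = d ∧ l₁ * l₃ ≠ 1 ∧
          4 * d ^ 2 * (d ^ 2 + l₃ ^ 2 - 2) = (d - l₃) ^ 2 * (1 - d ^ 2)) ∨
      (d ≠ 1 ∧ l₃ = d ∧
          4 * d ^ 2 * (d ^ 2 + l₁ ^ 2 - 2) = (d - l₁) ^ 2 * (1 - d ^ 2)) ∨
      (d = 1 ∧ 1 < l₃ ∧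
          l₁ ^ 2 * (5 * l₃ ^ 2 - 1) = 8 * l₁ * l₃ - 5 + l₃ ^ 2)) ∧
    (StarTwin.IsTypeIIStarTwin (Set.range (StarTwin.variant a b c d))
        (StarTwin.variant a b c d i) (StarTwin.variant a b c d j) R bv m ↔
      a ≠ c ∧
      ((d ≠ 1 ∧ l₁ = d ∧
          d ^ 2 * (d ^ 2 + l₃ ^ 2 - 2) = (d - l₃) ^ 2 * (1 - d ^ 2)) ∨
       (d ≠ 1 ∧ l₃ = d ∧
          d ^ 2 * (d ^ 2 + l₁ ^ 2 - 2) = (d - l₁) ^ 2 * (1 - d ^ 2)))) := by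
  obtain ⟨k₁, k₃, hk⟩ := hcof.cc1
  have hl2 : l₂ = 1 := StarTwin.middle_root_eq_one hl.1 hl.2.1 hk.1 hk.2.1
    fun x => (hl.eval x).symm.trans (hk.eval x)
  subst hl2
  have hl13 : l₁ ≤ 1 ∧ 1 ≤ l₃ := ⟨hl.1, hl.2.1⟩
  have hD : 0 < a * c - b ^ 2 := by
    have h := (hpos 0).det_pos
    have h0 : (StarTwin.variant a b c d 0).det = d * (a * c - b ^ 2) := StarTwin.det_base a b c d
    rw [h0] at h
    exact pos_of_mul_pos_right h hd.le
  have e0 := hl.eval 0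
  have e1 := hl.eval 1
  have e2 := hl.eval (-1)
  have hl1 : 0 < l₁ := by
    by_contra hneg
    have h := hl.eval l₁
    rw [sub_self, zero_mul, zero_mul] at h
    have h1 : 0 < (l₁ - a) * (l₁ - c) - b ^ 2 := by nlinarith
    rcases mul_eq_zero.mp h with h | h <;> linarith
  refine ⟨⟨hl1, hl13.1, rfl, hl13.2⟩, ?_⟩
  have hsum : d + (a + c - 1) = l₁ + l₃ := by linarith
  have h1 : (1 - d) * ((1 - a) * (1 - c) - b ^ 2) = 0 := by rw [e1]; ring
  obtain ⟨hδ, P, hP, hPs, α, β, γ, s, hs, hαγ, hβ, hU, hV, tw⟩ :=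
    StarTwin.exists_conj_base hb.ne' htwin hcof.cc2
  have hα : 0 < α := by rcases hαγ with ⟨rfl, rfl⟩ | ⟨rfl, rfl⟩ <;> assumption
  have hγ : 0 < γ := by rcases hαγ with ⟨rfl, rfl⟩ | ⟨rfl, rfl⟩ <;> assumption
  have hUM : StarTwin.base α β γ d ∈ Set.range (StarTwin.variant a b c d) :=
    hU ▸ hPs.conj_mem ⟨i, rfl⟩
  have hVM : StarTwin.baseTwin α β γ d ∈ Set.range (StarTwin.variant a b c d) :=
    hV ▸ hPs.conj_mem ⟨j, rfl⟩
  have htr := fun n => StarTwin.hasStarRotations_conj_iff (n := n) hP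
    (fun _ hX => hPs.conj_mem hX) (fun _ hX => hPs.transpose.conj_mem hX)
    (M := Set.range (StarTwin.variant a b c d)) (U := StarTwin.variant a b c d i)
    (V := StarTwin.variant a b c d j) (R := R) (m := m)
  rw [hU, hV] at htr tw
  have hhalf : StarTwin.IsTypeIIHalfStarTwin (Set.range (StarTwin.variant a b c d))
      (StarTwin.variant a b c d i) (StarTwin.variant a b c d j) R bv m ↔
      StarTwin.HasStarRotations (Set.range (StarTwin.variant a b c d))
        (StarTwin.variant a b c d i) (StarTwin.variant a b c d j) R m 2 ∧
      ¬ StarTwin.HasStarRotations (Set.range (StarTwin.variant a b c d))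
        (StarTwin.variant a b c d i) (StarTwin.variant a b c d j) R m 3 :=
    ⟨fun h => ⟨h.half_star, h.not_star⟩, fun h => ⟨⟨i, rfl⟩, ⟨j, rfl⟩, htwin, hcof, h.1, h.2⟩⟩
  have hstar : StarTwin.IsTypeIIStarTwin (Set.range (StarTwin.variant a b c d))
      (StarTwin.variant a b c d i) (StarTwin.variant a b c d j) R bv m ↔
      StarTwin.HasStarRotations (Set.range (StarTwin.variant a b c d))
        (StarTwin.variant a b c d i) (StarTwin.variant a b c d j) R m 3 :=
    ⟨fun h => h.star, fun h => ⟨⟨i, rfl⟩, ⟨j, rfl⟩, htwin, hcof, h⟩⟩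
  rw [hhalf, hstar, ← htr, ← htr]
  by_cases hd1 : d = 1
  · subst hd1
    have hprod : a * c - b ^ 2 = l₁ * l₃ := by linarith
    obtain ⟨s3, s2⟩ := StarTwin.core_of_one hb.ne' hδ hs hαγ hβ hα hγ hD hUM hVM tw
      (by linarith) hprod
    have hl3 : 1 < l₃ := by
      refine lt_of_le_of_ne hl13.2 fun h => hδ ?_
      rw [← h] at hsum hprod
      linear_combination hprod - hsum
    constructor
    · rw [s2]
      constructor
      · exact fun h => Or.inr (Or.inr ⟨rfl, hl3, h.1⟩)
      · rintro (h | h | h)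
        exacts [absurd rfl h.1, absurd rfl h.1, ⟨h.2.2, s3⟩]
    · constructor
      · exact fun h => absurd h s3
      · rintro ⟨-, h | h⟩
        exacts [absurd rfl h.1, absurd rfl h.1]
  · have hB := (mul_eq_zero.mp h1).resolve_left (sub_ne_zero.mpr (Ne.symm hd1))
    have hprod : d * (a + c - 1) = l₁ * l₃ := by linear_combination -d * hB - e0
    obtain ⟨s3, s2⟩ := StarTwin.core_of_ne_one hb.ne' hd hd1 hδ hs hαγ hβ hα hγ hD hUM hVM tw hB
    have hdl : a + c - 1 ≠ d := by
      intro h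
      apply hδ
      linear_combination hB + (1 - d) * h
    rw [s2, s3]
    obtain ⟨l, hl'⟩ : ∃ l, l = a + c - 1 := ⟨_, rfl⟩
    rw [← hl'] at hsum hprod hdl ⊢
    -- Besides `1` the eigenvalues are `d` and `l`; which of them is the smaller one separates the
    -- first two alternatives.
    have hcases : (l₁ - d) * (l₁ - l) = 0 := by linear_combination -l₁ * hsum + hprod
    rcases mul_eq_zero.mp hcases with h | h
    · have hd' : l₁ = d := by linarith
      have hl3 : l₃ = l := by linarith
      subst hd' hl3
      constructor
      · constructor
        · exact fun h => Or.inl ⟨hd1, rfl, h.2, h.1⟩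
        · rintro (h | h | h)
          exacts [⟨h.2.2.2, h.2.2.1⟩, absurd h.2.1 hdl, absurd h.1 hd1]
      · refine and_congr_right fun _ => ?_
        constructor
        · exact fun h => Or.inl ⟨hd1, rfl, h⟩
        · rintro (h | h)
          exacts [h.2.2, absurd h.2.1 hdl]
    · have hd' : l₁ = l := by linarith
      have hl3 : l₃ = d := by linarith
      subst hd' hl3
      constructor
      · constructor
        · exact fun h => Or.inr (Or.inl ⟨hd1, rfl, h.1⟩)
        · rintro (h | h | h)
          · exact absurd h.2.1 hdl
          · refine ⟨h.2.2, fun hD1 => ?_⟩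
            have h2 := h.2.2
            -- With `l₃ = d` the condition `l₁ l₃ ≠ 1` is automatic: otherwise the equation reduces
            -- to `4 l₃² = 1 - l₃²`, contradicting `1 ≤ l₃`.
            have h3 : l₃ ^ 2 + l₁ ^ 2 - 2 = (l₃ - l₁) ^ 2 := by linear_combination 2 * hD1
            rw [h3, mul_comm] at h2
            have h4 := mul_left_cancel₀ (pow_ne_zero 2 (sub_ne_zero.mpr (Ne.symm hdl))) h2
            nlinarith
          · exact absurd h.1 hd1
      · refine and_congr_right fun _ => ?_
        constructor
        · exact fun h => Or.inr ⟨hd1, rfl, h⟩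
        · rintro (h | h)
          exacts [absurd h.2.1 hdl, h.2.2]
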